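/- **Conventions.** Ordinals and cardinals are von Neumann ordinals; for a regular cardinal $\theta$, $H_\theta$ is the set of all sets hereditarily of cardinality $<\theta$, and $M\prec H_\theta$ means that $(M,\in)$ is an elementary submodel of $(H_\theta,\in)$. Write $x\ll\theta$ if $\mathcal P(\mathcal P(x))\in H_\theta$, let $\mathrm{Hull}(M,x)=\{f(x): f\in M \text{ a function},\ x\in\mathrm{dom}(f)\}$, and write $x\parallel_{\omega_1}M$ if $\mathrm{Hull}(M,x)\cap\omega_1=M\cap\omega_1$. For a forcing $\mathbb P\in M\prec H_\theta$, a condition $p^*$ is *strongly $(M,\mathbb P)$-semigeneric* if for every $q\le p^*$ there is a condition $t=\mathrm{tr}(q|M)\in\mathbb P$, called a *trace* of $q$, such that $t\parallel_{\omega_1}M$ and every $r\in \mathrm{Hull}(M,t)\cap\mathbb P$ with $r\le t$ is compatible with $q$. $\mathbb P$ is *strongly semiproper with respect to $M$* if every $p\in\mathbb P\cap M$ has a strongly $(M,\mathbb P)$-semigeneric extension $p^*\le p$. Let $\mathcal K$ be a set of uncountable regular cardinals with $\omega_1\notin\mathcal K$, let $\lambda=\sup\mathcal K$, and let $\mu\gg\lambda$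 be a regular cardinal. **The game.** For a countable $M\prec H_\mu$ with $\mathcal K\in M$, the game on $(M,\mathcal K)$ has $\omega$ rounds. Put $M_0=M$. In round $n$, player I plays $(\kappa_n,\nu_n)$ with $\kappa_n\in\mathcal K\cap M_n$ and $\nu_n\in\kappa_n$, and player II must answer with $\xi_n\in\kappa_n\setminus\nu_n$ such that $M_{n+1}:=\mathrm{Hull}(M_n,\xi_n)$ satisfies $M_{n+1}\cap\omega_1=M_n\cap\omega_1$; otherwise II loses. II wins if II loses in no round. A strategy for II is a function assigning to each nonempty finite sequence of pairs $(\kappa,\nu)$ with $\nu\in\kappa\in\mathcal K$ an ordinal in $\lambda$. For a finite run $\mathtt r$ of $n$ rounds, $M\ltimes\mathtt r:=M_n$. Let $\mathcal W_0$ be the set of countable $M\prec H_\mu$ with $\mathcal K\in M$ for which II has a winning strategy. **The forcing.** A condition of $\mathbb P_0(\mathcal K)$ is a finite set $p$ of triples $(M,\mathtt r,\Sigma)$, where $M\in\mathcal W_0$, $\Sigma$ is a winning strategy for II in the game on $(M,\mathcal K)$ and $\mathtt r$ is a finite run of that game in which II follows $\Sigma$, such that for any two elements $(M_1,\mathtt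 r_1,\Sigma_1),(M_2,\mathtt r_2,\Sigma_2)$ of $p$: if $M_1\cap\omega_1=M_2\cap\omega_1$, the two triples are equal; if $M_1\cap\omega_1<M_2\cap\omega_1$, then $(M_1,\mathtt r_1,\Sigma_1)\in M_2\ltimes\mathtt r_2$. Put $q\le p$ if for every $(M,\mathtt r,\Sigma)\in p$ there is $(M,\mathtt r',\Sigma)\in q$ with $\mathtt r'$ extending $\mathtt r$. **Proposition.** Let $\theta\gg\mu$ be a regular cardinal and let $N\prec H_\theta$ be countable with $\mathbb P_0(\mathcal K)\in N$ and $N\cap H_\mu\in\mathcal W_0$. Then $\mathbb P_0(\mathcal K)$ is strongly semiproper with respect to $N$. Moreover, for every $p\in\mathbb P_0(\mathcal K)\cap N$ and every winning strategy $\Sigma_N$ for II in the game on $(N\cap H_\mu,\mathcal K)$, the set $$p^*=p\cup\{(N\cap H_\mu,\emptyset,\Sigma_N)\}$$ is a strongly $(N,\mathbb P_0(\mathcal K))$-semigeneric condition with $p^*\le p$, and for every $q\le p^*$ the set $\{(M,\mathtt r,\Sigma)\in q: M\cap\omega_1\in N\}$ is a trace of $q$. -/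

import Mathlib

universe u

namespace NambaForcing

open ZFSet Cardinal FirstOrder

/-! The set-theoretic universe is `ZFSet.{u}`; ordinals and cardinals are von Neumann ordinals. -/

/-! ### The structures `(H_θ, ∈)` and elementary submodels -/

/-- `H_θ`, the set of all sets hereditarily of cardinality less than `θ`. (Every set hereditarily
of cardinality less than a regular `θ` lies in `V_θ`, see `mem_H`.) -/
noncomputable def H (θ : Cardinal.{u}) : ZFSet.{u} :=
  ZFSet.sep (fun x => x.Hereditarily fun y => y.card < θ) (vonNeumann θ.ord)

theorem rank_lt_of_hereditarily {θ : Cardinal.{u}} (hθ : θ.IsRegular) (x : ZFSet.{u}) :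
    (x.Hereditarily fun y => y.card < θ) → x.rank < θ.ord := by
  induction x using ZFSet.inductionOn with
  | _ x ih =>
    intro hx
    rw [hereditarily_iff] at hx
    obtain ⟨hcard, hmem⟩ := hx
    let f : Shrink.{u} x → Ordinal.{u} :=
      fun y => Order.succ (((equivShrink x).symm y : x) : ZFSet.{u}).rank
    have hlt : (⨆ i, f i) < θ.ord := by
      apply Ordinal.iSup_lt_of_lt_cof
      · rw [hθ.cof_ord]
        exact hcard
      · intro i
        have hi := ((equivShrink x).symm i).2
        exact (isSuccLimit_ord hθ.aleph0_le).succ_lt (ih _ hi (hmem _ hi))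
    refine lt_of_le_of_lt ?_ hlt
    rw [rank_le_iff]
    intro y hy
    have h1 : f (equivShrink x ⟨y, hy⟩) ≤ ⨆ i, f i := Ordinal.le_iSup f _
    have h2 : f (equivShrink x ⟨y, hy⟩) = Order.succ y.rank := by
      simp only [f, Equiv.symm_apply_apply]
    rw [h2] at h1
    exact Order.succ_le_iff.1 h1

theorem mem_H {θ : Cardinal.{u}} (hθ : θ.IsRegular) {x : ZFSet.{u}} :
    x ∈ H θ ↔ x.Hereditarily fun y => y.card < θ := by
  rw [H, ZFSet.mem_sep, mem_vonNeumann]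
  exact ⟨fun h => h.2, fun h => ⟨rank_lt_of_hereditarily hθ x h, h⟩⟩

/-- `x ≪ θ`: the double power set of `x` belongs to `H_θ`. -/
def MuchLess (x : ZFSet.{u}) (θ : Cardinal.{u}) : Prop :=
  powerset (powerset x) ∈ H θ

/-- The only non-logical symbol of the language of set theory: a binary relation. -/
inductive MemSymbol : ℕ → Type
  | mem : MemSymbol 2

/-- The first-order language of set theory. -/
def setLanguage : Language := ⟨fun _ => Empty, MemSymbol⟩

/-- Every set is a structure with its true membership relation. -/
instance (A : ZFSet.{u}) : setLanguage.Structure {x : ZFSet.{u} // x ∈ A} where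
  funMap := fun f _ => Empty.elim f
  RelMap := fun R => match R with
    | .mem => fun v => (v 0).1 ∈ (v 1).1

/-- `M ≺ A`: the set `M` is (the universe of) an elementary submodel of `(A, ∈)`. -/
def IsElemSubmodel (M A : ZFSet.{u}) : Prop :=
  M ⊆ A ∧ ∃ S : setLanguage.ElementarySubstructure {x : ZFSet.{u} // x ∈ A},
    ∀ x : {x : ZFSet.{u} // x ∈ A}, x ∈ S ↔ x.1 ∈ M

/-! ### Cardinals and hulls -/

/-- The von Neumann ordinal `ω₁`. -/
noncomputable def omega1 : ZFSet.{u} := (Cardinal.aleph 1).ord.toZFSet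

/-- `κ` is an uncountable regular cardinal (as a von Neumann ordinal). -/
def IsUncountableRegular (κ : ZFSet.{u}) : Prop :=
  ∃ c : Cardinal.{u}, c.IsRegular ∧ ℵ₀ < c ∧ κ = c.ord.toZFSet

/-- `Hull(M, x) = { f(x) : f ∈ M a function with x ∈ dom f }`. -/
noncomputable def Hull (M x : ZFSet.{u}) : ZFSet.{u} :=
  ZFSet.sep (fun y => ∃ f ∈ M, (∃ A B, IsFunc A B f) ∧ pair x y ∈ f)
    (ZFSet.sUnion (ZFSet.sUnion (ZFSet.sUnion M)))

theorem mem_Hull {M x y : ZFSet.{u}} :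
    y ∈ Hull M x ↔ ∃ f ∈ M, (∃ A B, IsFunc A B f) ∧ pair x y ∈ f := by
  rw [Hull, ZFSet.mem_sep]
  refine ⟨fun h => h.2, fun h => ⟨?_, h⟩⟩
  obtain ⟨f, hf, -, hxy⟩ := h
  refine mem_sUnion_of_mem (z := {x, y}) (by simp) (mem_sUnion_of_mem (z := pair x y) ?_
    (mem_sUnion_of_mem hxy hf))
  simp [pair]

/-- `x ∥_{ω₁} M`: `Hull(M, x)` and `M` have the same countable ordinals. -/
def ParallelOmega1 (x M : ZFSet.{u}) : Prop :=
  Hull M x ∩ omega1 = M ∩ omega1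

/-! ### Strong semiproperness -/

section Forcing

variable (P : ZFSet.{u}) (le : ZFSet.{u} → ZFSet.{u} → Prop)

/-- Two conditions of the forcing `(P, le)` are compatible. -/
def Compatible (p q : ZFSet.{u}) : Prop := ∃ s ∈ P, le s p ∧ le s q

/-- The condition `t` can serve as `trace(q | M)`. -/
def IsTrace (M q t : ZFSet.{u}) : Prop :=
  t ∈ P ∧ ParallelOmega1 t M ∧ ∀ r ∈ Hull M t, r ∈ P → le r t → Compatible P le r q

/-- The condition `p'` is strongly `(M, P)`-semigeneric. -/
def StronglySemigeneric (M p' : ZFSet.{u}) : Prop :=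
  p' ∈ P ∧ ∀ q ∈ P, le q p' → ∃ t, IsTrace P le M q t

/-- The forcing `(P, le)` is strongly semiproper with respect to `M` (where `P ∈ M`). -/
def StronglySemiproper (M : ZFSet.{u}) : Prop :=
  ∀ p ∈ P, p ∈ M → ∃ p', le p' p ∧ StronglySemigeneric P le M p'

end Forcing

/-! ### The multiple Namba game -/

/-- The finite sequence with the given entries, as a set: a function with domain the length. -/
noncomputable def seqCode (l : List ZFSet.{u}) : ZFSet.{u} :=
  ZFSet.range fun i : Fin l.length => pair (Ordinal.toZFSet ((i : ℕ) : Ordinal.{u})) (l.get i)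

/-- One round of the game: player I plays `(κ, ν)` and player II answers `ξ`. -/
structure Round : Type (u + 1) where
  κ : ZFSet.{u}
  ν : ZFSet.{u}
  ξ : ZFSet.{u}

/-- The move of player I in a round. -/
def Round.moveI (t : Round.{u}) : ZFSet.{u} := pair t.κ t.ν

/-- A round as a set. -/
def Round.code (t : Round.{u}) : ZFSet.{u} := pair t.moveI t.ξ

/-- A finite run as a set. -/
noncomputable def runCode (r : List Round.{u}) : ZFSet.{u} := seqCode (r.map Round.code)

/-- `M ⋉ r`: the last model of the sequence `M₀ = M`, `Mₙ₊₁ = Hull(Mₙ, ξₙ)` along `r`. -/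
noncomputable def model (M : ZFSet.{u}) (r : List Round.{u}) : ZFSet.{u} :=
  r.foldl (fun M' t => Hull M' t.ξ) M

/-- `r` is a finite run of the game on `(M, K)` in which player II has not lost:
in each round `κₙ ∈ K ∩ Mₙ`, `νₙ ∈ κₙ`, `ξₙ ∈ κₙ \ νₙ` and `Mₙ₊₁ ∩ ω₁ = Mₙ ∩ ω₁`. -/
def IsRun (K : ZFSet.{u}) : ZFSet.{u} → List Round.{u} → Prop
  | _, [] => True
  | M, t :: r => (t.κ ∈ K ∧ t.κ ∈ M ∧ t.ν ∈ t.κ) ∧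
      (t.ξ ∈ t.κ ∧ t.ξ ∉ t.ν ∧ Hull M t.ξ ∩ omega1 = M ∩ omega1) ∧ IsRun K (Hull M t.ξ) r

/-- `m` is a pair `(κ, ν)` with `κ ∈ K` and `ν ∈ κ`. -/
def IsMoveI (K m : ZFSet.{u}) : Prop := ∃ κ ∈ K, ∃ ν ∈ κ, m = pair κ ν

/-- `S` is a strategy for player II: a function assigning an ordinal below `sup K` to every
nonempty finite sequence of moves of player I. -/
def IsStrategyII (K S : ZFSet.{u}) : Prop :=
  (∀ t ∈ S, ∃ l : List ZFSet.{u}, l ≠ [] ∧ (∀ m ∈ l, IsMoveI K m) ∧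
    ∃ ξ ∈ ZFSet.sUnion K, t = pair (seqCode l) ξ) ∧
  ∀ l : List ZFSet.{u}, l ≠ [] → (∀ m ∈ l, IsMoveI K m) → ∃! ξ, pair (seqCode l) ξ ∈ S

/-- In the run `r`, player II follows the strategy `S`. -/
def Follows (S : ZFSet.{u}) (r : List Round.{u}) : Prop :=
  ∀ (s : List Round.{u}) (t : Round.{u}), (s ++ [t]) <+: r →
    pair (seqCode ((s ++ [t]).map Round.moveI)) t.ξ ∈ S

/-- `S` is a winning strategy for player II in the game on `(M, K)`: following `S`, player II does
not lose in any round, whatever player I plays. -/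
def IsWinningII (K M S : ZFSet.{u}) : Prop :=
  IsStrategyII K S ∧ ∀ r : List Round.{u}, IsRun K M r → Follows S r →
    ∀ κ ν ξ : ZFSet.{u}, κ ∈ K → κ ∈ model M r → ν ∈ κ →
      Follows S (r ++ [⟨κ, ν, ξ⟩]) → IsRun K M (r ++ [⟨κ, ν, ξ⟩])

/-- `M ∈ 𝒲₀`: `M` is a countable elementary submodel of `H_μ` with `K ∈ M` such that player II has
a winning strategy in the game on `(M, K)`. -/
def InW0 (μ : Cardinal.{u}) (K M : ZFSet.{u}) : Prop :=
  M.card ≤ ℵ₀ ∧ IsElemSubmodel M (H μ) ∧ K ∈ M ∧ ∃ S, IsWinningII K M S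

/-! ### The multiple Namba forcing -/

/-- The triple `(M, r, S)` as a set. -/
noncomputable def triple (M : ZFSet.{u}) (r : List Round.{u}) (S : ZFSet.{u}) : ZFSet.{u} :=
  pair M (pair (runCode r) S)

/-- `p` is a condition of the multiple Namba forcing. -/
def IsCondition (μ : Cardinal.{u}) (K p : ZFSet.{u}) : Prop :=
  (p : Set ZFSet.{u}).Finite ∧
  (∀ x ∈ p, ∃ M r S, x = triple M r S ∧
    InW0 μ K M ∧ IsWinningII K M S ∧ IsRun K M r ∧ Follows S r) ∧
  (∀ M₁ r₁ S₁ M₂ r₂ S₂, triple M₁ r₁ S₁ ∈ p → triple M₂ r₂ S₂ ∈ p →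
    M₁ ∩ omega1 = M₂ ∩ omega1 → triple M₁ r₁ S₁ = triple M₂ r₂ S₂) ∧
  (∀ M₁ r₁ S₁ M₂ r₂ S₂, triple M₁ r₁ S₁ ∈ p → triple M₂ r₂ S₂ ∈ p →
    M₁ ∩ omega1 ∈ M₂ ∩ omega1 → triple M₁ r₁ S₁ ∈ model M₂ r₂)

/-- The order of the forcing: `Le q p` means that `q` is stronger than `p`. -/
def Le (q p : ZFSet.{u}) : Prop :=
  ∀ M r S, triple M r S ∈ p → ∃ r', triple M r' S ∈ q ∧ r <+: r'

/-- A set that has all triples occurring in conditions as elements. -/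
noncomputable def tripleBound (μ : Cardinal.{u}) (K : ZFSet.{u}) : ZFSet.{u} :=
  ZFSet.prod (powerset (H μ)) (ZFSet.prod
    (powerset (ZFSet.prod omega.{u}
      (ZFSet.prod (ZFSet.prod K (ZFSet.sUnion K)) (ZFSet.sUnion K))))
    (powerset (ZFSet.prod (powerset (ZFSet.prod omega.{u} (ZFSet.prod K (ZFSet.sUnion K))))
      (ZFSet.sUnion K))))

/-- The set of conditions of the multiple Namba forcing; see `mem_P0`. -/
noncomputable def P0 (μ : Cardinal.{u}) (K : ZFSet.{u}) : ZFSet.{u} :=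
  ZFSet.sep (IsCondition μ K) (powerset (tripleBound μ K))

theorem nat_toZFSet_mem_omega (n : ℕ) : Ordinal.toZFSet (n : Ordinal.{u}) ∈ omega.{u} := by
  induction n with
  | zero => simp
  | succ n ih =>
    rw [Nat.cast_succ, Ordinal.toZFSet_add_one]
    exact omega_succ ih

theorem seqCode_subset {A : ZFSet.{u}} {l : List ZFSet.{u}} (h : ∀ m ∈ l, m ∈ A) :
    seqCode l ⊆ ZFSet.prod omega.{u} A := by
  intro x hx
  rw [seqCode, ZFSet.mem_range] at hx
  obtain ⟨i, rfl⟩ := hx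
  rw [pair_mem_prod]
  exact ⟨nat_toZFSet_mem_omega _, h _ (List.get_mem l i)⟩

theorem round_mem_of_isRun {K : ZFSet.{u}} {r : List Round.{u}} :
    ∀ {M : ZFSet.{u}}, IsRun K M r → ∀ t ∈ r, t.κ ∈ K ∧ t.ν ∈ t.κ ∧ t.ξ ∈ t.κ := by
  induction r with
  | nil => intro M _ t ht; simp at ht
  | cons a r ih =>
    intro M h t ht
    obtain ⟨h1, h2, h3⟩ := h
    rcases List.mem_cons.1 ht with rfl | ht
    · exact ⟨h1.1, h1.2.2, h2.1⟩
    · exact ih h3 t ht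

theorem mem_P0 {μ : Cardinal.{u}} {K p : ZFSet.{u}} : p ∈ P0 μ K ↔ IsCondition μ K p := by
  rw [P0, ZFSet.mem_sep]
  refine ⟨fun h => h.2, fun h => ⟨?_, h⟩⟩
  rw [mem_powerset]
  intro x hx
  obtain ⟨M, r, S, rfl, hM, hS, hr, -⟩ := h.2.1 x hx
  rw [triple, tripleBound, pair_mem_prod, pair_mem_prod, mem_powerset, mem_powerset, mem_powerset]
  refine ⟨hM.2.1.1, seqCode_subset ?_, ?_⟩
  · intro m hm
    obtain ⟨t, ht, rfl⟩ := List.mem_map.1 hm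
    obtain ⟨h1, h2, h3⟩ := round_mem_of_isRun hr t ht
    rw [Round.code, Round.moveI, pair_mem_prod, pair_mem_prod]
    exact ⟨⟨h1, mem_sUnion_of_mem h2 h1⟩, mem_sUnion_of_mem h3 h1⟩
  · intro t ht
    obtain ⟨l, -, hl, ξ, hξ, rfl⟩ := hS.1.1 t ht
    rw [pair_mem_prod, mem_powerset]
    refine ⟨seqCode_subset ?_, hξ⟩
    intro m hm
    obtain ⟨κ, hκ, ν, hν, rfl⟩ := hl m hm
    rw [pair_mem_prod]
    exact ⟨hκ, mem_sUnion_of_mem hν hκ⟩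

/-- The part of `q` below `N`: all `(M, r, S) ∈ q` with `M ∩ ω₁ ∈ N`. -/
noncomputable def traceBelow (q N : ZFSet.{u}) : ZFSet.{u} :=
  ZFSet.sep (fun x => ∃ M r S, x = triple M r S ∧ M ∩ omega1 ∈ N) q

end NambaForcing

namespace NambaForcing

open ZFSet Cardinal FirstOrder

/-! ### Closure properties of `H_χ` -/

section HClosure

variable {χ : Cardinal.{u}} (hχ : χ.IsRegular)
include hχ

/-! A condition `q ≤ p*` contains a triple `(N ∩ H_μ, s, Σ_N)`. Let `B = (N ∩ H_μ) ⋉ s` and let `t`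
be the part of `q` below `N`. Coherence of `q` puts each triple of `t` into `B`. Hulls of elementary
submodels are elementary (`IsElemSubmodel.Hull`), so `B ≺ H_μ`; as `t` is finite, `t ∈ B`, and
therefore `Hull(N, t) ⊆ N ⋉ s`.

The obstacle is that `N ⋉ s` is built with all functions of `N`, while the game controls only `B`,
built with functions in `H_μ`. It is removed by `mem_model_inter_H`: if `X ∈ N` and `X ⊆ H_μ`, every
element of `X` in `N ⋉ s` lies in `B`. Indeed, a function in `N` with domain in `H_μ` and values in
`X` is itself in `H_μ`, and currying carries this through the rounds (`RelationsReflect`).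

There are two applications. For `X = ⋃ K`, which includes `ω₁` if `K` is nonempty: no countable
ordinals are added along `s`, so `t ∥ N`. For `X = P0`: a condition `r ∈ Hull(N, t)` is in `B`, and
being finite it is a subset of `B`. The triples of `q` outside `t` are the one at `N` and those of
greater height; the last models of the latter have the triple at `N` as an element and hence include
`B`. So `r ∪ (q \ t)` is a condition (`IsCondition.union`); it extends `r`, and it extends `q` as
soon as `r ≤ t`.

This argument needs `μ` uncountable. The case `μ = ℵ₀` forces `K = ∅` and leaves a single possible
triple. -/

theorem mem_H_iff {x : ZFSet.{u}} : x ∈ H χ ↔ x.card < χ ∧ ∀ y ∈ x, y ∈ H χ := by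
  rw [mem_H hχ, hereditarily_iff]
  simp only [mem_H hχ]

theorem H_trans {x y : ZFSet.{u}} (hx : x ∈ H χ) (hy : y ∈ x) : y ∈ H χ :=
  ((mem_H_iff hχ).1 hx).2 y hy

theorem H_subset {x y : ZFSet.{u}} (hy : y ∈ H χ) (h : x ⊆ y) : x ∈ H χ :=
  (mem_H_iff hχ).2 ⟨(card_mono h).trans_lt ((mem_H_iff hχ).1 hy).1,
    fun _ hz => H_trans hχ hy (h hz)⟩

theorem H_range {ι : Type u} (F : ι → ZFSet.{u}) (hι : #ι < χ) (hF : ∀ i, F i ∈ H χ) :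
    ZFSet.range F ∈ H χ := by
  refine (mem_H_iff hχ).2 ⟨lt_of_le_of_lt ?_ hι, ?_⟩
  · simpa using lift_card_range_le (f := F)
  · intro y hy
    obtain ⟨i, rfl⟩ := mem_range.1 hy
    exact hF i

theorem H_empty : (∅ : ZFSet.{u}) ∈ H χ :=
  (mem_H_iff hχ).2 ⟨by simpa using hχ.pos, fun y hy => (notMem_empty y hy).elim⟩

theorem H_insert {x y : ZFSet.{u}} (hx : x ∈ H χ) (hy : y ∈ H χ) : insert x y ∈ H χ := by
  refine (mem_H_iff hχ).2 ⟨card_insert_le.trans_lt ?_, ?_⟩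
  · exact add_lt_of_lt hχ.aleph0_le ((mem_H_iff hχ).1 hy).1
      (one_lt_aleph0.trans_le hχ.aleph0_le)
  · intro z hz
    rcases mem_insert_iff.1 hz with rfl | hz
    · exact hx
    · exact H_trans hχ hy hz

theorem H_singleton {x : ZFSet.{u}} (hx : x ∈ H χ) : ({x} : ZFSet.{u}) ∈ H χ := by
  have h := H_insert hχ hx (H_empty hχ)
  simpa using h

theorem H_pair {x y : ZFSet.{u}} (hx : x ∈ H χ) (hy : y ∈ H χ) : pair x y ∈ H χ :=
  H_insert hχ (H_singleton hχ hx) (H_singleton hχ (H_insert hχ hx (H_singleton hχ hy)))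

theorem H_of_pair {x y : ZFSet.{u}} (h : pair x y ∈ H χ) : x ∈ H χ ∧ y ∈ H χ := by
  have h1 : ({x, y} : ZFSet.{u}) ∈ H χ := H_trans hχ h (by simp [pair])
  exact ⟨H_trans hχ h1 (by simp), H_trans hχ h1 (by simp)⟩

theorem H_sUnion {x : ZFSet.{u}} (hx : x ∈ H χ) : ZFSet.sUnion x ∈ H χ := by
  refine (mem_H_iff hχ).2 ⟨?_, ?_⟩
  · let f : Shrink.{u} x → ZFSet.{u} := fun i => ((equivShrink x).symm i : x)
    have h1 : ZFSet.sUnion x ⊆ ⋃ i, f i := by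
      intro y hy
      obtain ⟨z, hz, hyz⟩ := mem_sUnion.1 hy
      refine mem_iUnion.2 ⟨equivShrink x ⟨z, hz⟩, ?_⟩
      simpa [f] using hyz
    refine (card_mono h1).trans_lt ?_
    have h2 := lift_card_iUnion_le_sum_card (f := f)
    rw [lift_id] at h2
    refine h2.trans_lt (sum_lt_of_isRegular hχ ((mem_H_iff hχ).1 hx).1 fun i => ?_)
    exact ((mem_H_iff hχ).1 (H_trans hχ hx ((equivShrink x).symm i).2)).1
  · intro y hy
    obtain ⟨z, hz, hyz⟩ := mem_sUnion.1 hy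
    exact H_trans hχ (H_trans hχ hx hz) hyz

/-- Replacement in `H_χ`: the graph of any assignment `F : x → H_χ` with `x ∈ H_χ`. -/
theorem H_replacement {x : ZFSet.{u}} (hx : x ∈ H χ) (F : ZFSet.{u} → ZFSet.{u})
    (hF : ∀ a ∈ x, F a ∈ H χ) : ∃ y ∈ H χ, ∀ z, z ∈ y ↔ ∃ a ∈ x, F a = z := by
  refine ⟨ZFSet.range fun i : Shrink.{u} x => F ((equivShrink x).symm i : x),
    H_range hχ _ ((mem_H_iff hχ).1 hx).1 fun i => hF _ ((equivShrink x).symm i).2, fun z => ?_⟩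
  rw [mem_range]
  constructor
  · rintro ⟨i, rfl⟩
    exact ⟨_, ((equivShrink x).symm i).2, rfl⟩
  · rintro ⟨a, ha, rfl⟩
    exact ⟨equivShrink x ⟨a, ha⟩, by simp⟩

theorem H_prod {x y : ZFSet.{u}} (hx : x ∈ H χ) (hy : y ∈ H χ) : ZFSet.prod x y ∈ H χ := by
  have hι : #(Shrink.{u} x × Shrink.{u} y) < χ := by
    rw [mk_prod, lift_id, lift_id]
    exact mul_lt_of_lt hχ.aleph0_le ((mem_H_iff hχ).1 hx).1 ((mem_H_iff hχ).1 hy).1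
  refine H_subset hχ (H_range hχ (fun i : Shrink.{u} x × Shrink.{u} y =>
    pair ((equivShrink x).symm i.1 : x) ((equivShrink y).symm i.2 : y)) hι fun i =>
      H_pair hχ (H_trans hχ hx ((equivShrink x).symm i.1).2)
        (H_trans hχ hy ((equivShrink y).symm i.2).2)) ?_
  intro z hz
  obtain ⟨a, ha, b, hb, rfl⟩ := mem_prod.1 hz
  exact mem_range.2 ⟨(equivShrink x ⟨a, ha⟩, equivShrink y ⟨b, hb⟩), by simp⟩

theorem H_of_finite {x : ZFSet.{u}} (hfin : (x : Set ZFSet.{u}).Finite) (h : ∀ y ∈ x, y ∈ H χ) :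
    x ∈ H χ := by
  refine (mem_H_iff hχ).2 ⟨lt_of_lt_of_le ?_ hχ.aleph0_le, h⟩
  rw [← lift_lt_aleph0.{u, u + 1}, ← cardinalMk_coe_sort, lt_aleph0_iff_finite]
  exact hfin.to_subtype

/-- A single-valued relation with domain in `H_χ` and values in `H_χ` belongs to `H_χ`. -/
theorem H_of_singleValued {D X g : ZFSet.{u}} (hD : D ∈ H χ) (hX : X ⊆ H χ)
    (hg : g ⊆ ZFSet.prod D X) (hs : ∀ a b b', pair a b ∈ g → pair a b' ∈ g → b = b') :
    g ∈ H χ := by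
  classical
  obtain ⟨y, hy, hyg⟩ := H_replacement hχ hD
    (fun a => if h : ∃ b, pair a b ∈ g then pair a h.choose else ∅) (by
      intro a ha
      split_ifs with h
      · exact H_pair hχ (H_trans hχ hD ha) (hX (pair_mem_prod.1 (hg h.choose_spec)).2)
      · exact H_empty hχ)
  refine H_subset hχ hy fun z hz => ?_
  obtain ⟨a, ha, b, hb, rfl⟩ := mem_prod.1 (hg hz)
  have h : ∃ b, pair a b ∈ g := ⟨b, hz⟩
  refine (hyg _).2 ⟨a, ha, ?_⟩
  rw [dif_pos h, hs a _ _ h.choose_spec hz]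

end HClosure

theorem fst_mem_sUnion_sUnion {x y f : ZFSet.{u}} (h : pair x y ∈ f) :
    x ∈ ZFSet.sUnion (ZFSet.sUnion f) :=
  mem_sUnion_of_mem (z := {x, y}) (by simp) (mem_sUnion_of_mem (z := pair x y) (by simp [pair]) h)

theorem snd_mem_sUnion_sUnion {x y f : ZFSet.{u}} (h : pair x y ∈ f) :
    y ∈ ZFSet.sUnion (ZFSet.sUnion f) :=
  mem_sUnion_of_mem (z := {x, y}) (by simp) (mem_sUnion_of_mem (z := pair x y) (by simp [pair]) h)

theorem exists_isFunc_iff {f : ZFSet.{u}} : (∃ A B, IsFunc A B f) ↔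
    (∀ z ∈ f, ∃ a b, z = pair a b) ∧ ∀ a b b', pair a b ∈ f → pair a b' ∈ f → b = b' := by
  constructor
  · rintro ⟨A, B, hf, hu⟩
    refine ⟨fun z hz => ?_, fun a b b' hb hb' => ?_⟩
    · obtain ⟨a, -, b, -, rfl⟩ := mem_prod.1 (hf hz)
      exact ⟨a, b, rfl⟩
    · exact (hu a (pair_mem_prod.1 (hf hb)).1).unique hb hb'
  · rintro ⟨hp, hu⟩
    refine ⟨ZFSet.sep (fun a => ∃ b, pair a b ∈ f) (ZFSet.sUnion (ZFSet.sUnion f)),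
      ZFSet.sUnion (ZFSet.sUnion f), fun z hz => ?_, fun a ha => ?_⟩
    · obtain ⟨a, b, rfl⟩ := hp z hz
      exact pair_mem_prod.2 ⟨mem_sep.2 ⟨fst_mem_sUnion_sUnion hz, b, hz⟩,
        snd_mem_sUnion_sUnion hz⟩
    · obtain ⟨b, hb⟩ := (mem_sep.1 ha).2
      exact ⟨b, hb, fun b' hb' => hu a b' b hb' hb⟩

/-! ### First-order predicates over `H_χ` -/

/-- The underlying type of the structure `(H_χ, ∈)`. -/
abbrev HType (χ : Cardinal.{u}) : Type (u + 1) := {x : ZFSet.{u} // x ∈ H χ}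

/-- A predicate on assignments `α → H_χ` that is defined by a formula of set theory. -/
def FO {χ : Cardinal.{u}} {α : Type} (P : (α → HType χ) → Prop) : Prop :=
  ∃ φ : setLanguage.Formula α, ∀ v, φ.Realize v ↔ P v

namespace FO

variable {χ : Cardinal.{u}} {α β : Type}

theorem mem {i j : α} : FO fun v : α → HType χ => (v i).1 ∈ (v j).1 := by
  let R : setLanguage.Relations 2 := MemSymbol.mem
  refine ⟨R.formula₂ (Language.Term.var i) (Language.Term.var j), fun v => ?_⟩
  rw [Language.Formula.realize_rel₂]
  rfl

theorem eq {i j : α} : FO fun v : α → HType χ => v i = v j :=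
  ⟨(Language.Term.var i).equal (Language.Term.var j), fun v => by
    rw [Language.Formula.realize_equal]; rfl⟩

theorem imp {P Q : (α → HType χ) → Prop} (hP : FO P) (hQ : FO Q) : FO fun v => P v → Q v := by
  obtain ⟨φ, hφ⟩ := hP
  obtain ⟨ψ, hψ⟩ := hQ
  exact ⟨φ.imp ψ, fun v => by rw [Language.Formula.realize_imp, hφ, hψ]⟩

theorem not {P : (α → HType χ) → Prop} (hP : FO P) : FO fun v => ¬ P v := by
  obtain ⟨φ, hφ⟩ := hP
  exact ⟨φ.not, fun v => by rw [Language.Formula.realize_not, hφ]⟩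

theorem congr {P Q : (α → HType χ) → Prop} (hP : FO P) (h : ∀ v, P v ↔ Q v) : FO Q := by
  obtain ⟨φ, hφ⟩ := hP
  exact ⟨φ, fun v => (hφ v).trans (h v)⟩

theorem and {P Q : (α → HType χ) → Prop} (hP : FO P) (hQ : FO Q) : FO fun v => P v ∧ Q v :=
  (hP.imp hQ.not).not.congr fun v => by tauto

theorem or {P Q : (α → HType χ) → Prop} (hP : FO P) (hQ : FO Q) : FO fun v => P v ∨ Q v :=
  (hP.not.imp hQ).congr fun v => by tauto

theorem iff {P Q : (α → HType χ) → Prop} (hP : FO P) (hQ : FO Q) : FO fun v => (P v ↔ Q v) :=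
  ((hP.imp hQ).and (hQ.imp hP)).congr fun v => by tauto

theorem relabel {P : (α → HType χ) → Prop} (e : α → β) (hP : FO P) :
    FO fun v : β → HType χ => P fun i => v (e i) := by
  obtain ⟨φ, hφ⟩ := hP
  exact ⟨φ.relabel e, fun v => by rw [Language.Formula.realize_relabel, hφ]; rfl⟩

theorem allFin {γ : Type} [Finite γ] {Q : (α → HType χ) → (γ → HType χ) → Prop}
    (hQ : FO fun w : α ⊕ γ → HType χ => Q (fun i => w (.inl i)) fun i => w (.inr i)) :
    FO fun v => ∀ x : γ → HType χ, Q v x := by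
  obtain ⟨φ, hφ⟩ := hQ
  refine ⟨φ.iAlls γ, fun v => ?_⟩
  rw [Language.Formula.realize_iAlls]
  exact forall_congr' fun x => hφ _

theorem forall_fin {γ : Type} [Finite γ] {Q : γ → (α → HType χ) → Prop} (hQ : ∀ i, FO (Q i)) :
    FO fun v => ∀ i, Q i v := by
  choose φ hφ using hQ
  exact ⟨Language.Formula.iInf φ, fun v => by
    rw [Language.Formula.realize_iInf]; exact forall_congr' fun i => hφ i v⟩

/-- Convention for quantifiers: the bound variable is `none` and the parameters are the `some i`.
With these combinators definability is checked along the shape of a predicate, without writing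
formulas. -/
theorem all {Q : (α → HType χ) → HType χ → Prop}
    (hQ : FO fun w : Option α → HType χ => Q (fun i => w (some i)) (w none)) :
    FO fun v => ∀ x : HType χ, Q v x := by
  refine (allFin (γ := Unit) (Q := fun v x => Q v (x ())) ?_).congr fun v =>
    ⟨fun h x => h fun _ => x, fun h x => h _⟩
  exact hQ.relabel fun i : Option α => i.elim (Sum.inr () : α ⊕ Unit) Sum.inl

theorem ex {Q : (α → HType χ) → HType χ → Prop}
    (hQ : FO fun w : Option α → HType χ => Q (fun i => w (some i)) (w none)) :
    FO fun v => ∃ x : HType χ, Q v x :=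
  (all (Q := fun v x => ¬ Q v x) hQ.not).not.congr fun v => by push Not; rfl

/-- Admits an arbitrary formula as a building block, as the Tarski–Vaught test for hulls requires.
-/
theorem realize {n : ℕ} (φ : setLanguage.BoundedFormula Empty n) :
    FO fun v : Fin n → HType χ => φ.Realize default v := by
  refine ⟨φ.toFormula.relabel (Sum.elim Empty.elim id), fun v => ?_⟩
  rw [Language.Formula.realize_relabel, Language.BoundedFormula.realize_toFormula]
  exact iff_of_eq (congrArg₂ _ (Subsingleton.elim _ _) rfl)

theorem subset (hχ : χ.IsRegular) {i j : α} :
    FO fun v : α → HType χ => (v i).1 ⊆ (v j).1 := by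
  refine FO.congr (P := fun v => ∀ z : HType χ, z.1 ∈ (v i).1 → z.1 ∈ (v j).1)
    (all (imp mem mem)) fun v => ⟨fun h z hz => h ⟨z, H_trans hχ (v i).2 hz⟩ hz, fun h z hz => h hz⟩

theorem eq_doubleton (hχ : χ.IsRegular) {i j k : α} :
    FO fun v : α → HType χ => (v i).1 = {(v j).1, (v k).1} := by
  refine FO.congr (P := fun v => ∀ z : HType χ, z.1 ∈ (v i).1 ↔ z = v j ∨ z = v k)
    (all (iff mem (or eq eq))) fun v => ?_
  constructor
  · intro h
    ext z
    rw [mem_pair]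
    constructor
    · intro hz
      rcases (h ⟨z, H_trans hχ (v i).2 hz⟩).1 hz with h | h
      · exact .inl (congrArg Subtype.val h)
      · exact .inr (congrArg Subtype.val h)
    · rintro (rfl | rfl)
      · exact (h _).2 (.inl rfl)
      · exact (h _).2 (.inr rfl)
  · intro h z
    rw [h, mem_pair, Subtype.ext_iff, Subtype.ext_iff]

theorem eq_pair (hχ : χ.IsRegular) {i j k : α} :
    FO fun v : α → HType χ => (v i).1 = pair (v j).1 (v k).1 := by
  refine FO.congr (P := fun v => ∃ a b : HType χ, a.1 = {(v j).1, (v j).1} ∧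
    b.1 = {(v j).1, (v k).1} ∧ (v i).1 = {a.1, b.1})
    (ex (ex (and (eq_doubleton hχ) (and (eq_doubleton hχ) (eq_doubleton hχ))))) fun v => ?_
  have hself : ({(v j).1, (v j).1} : ZFSet.{u}) = {(v j).1} := by ext; simp
  constructor
  · rintro ⟨a, b, ha, hb, hi⟩
    rw [hi, ha, hb, hself]; rfl
  · intro h
    exact ⟨⟨_, H_singleton hχ (v j).2⟩, ⟨_, H_insert hχ (v j).2 (H_singleton hχ (v k).2)⟩,
      hself.symm, rfl, h⟩

theorem pair_mem (hχ : χ.IsRegular) {i j k : α} :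
    FO fun v : α → HType χ => pair (v i).1 (v j).1 ∈ (v k).1 :=
  FO.congr (P := fun v => ∃ a : HType χ, a.1 = pair (v i).1 (v j).1 ∧ a.1 ∈ (v k).1)
    (ex (and (eq_pair hχ) mem)) fun v =>
      ⟨fun ⟨_, h, h'⟩ => h ▸ h', fun h => ⟨⟨_, H_trans hχ (v k).2 h⟩, rfl, h⟩⟩

end FO

/-! ### Elementary submodels of `H_χ` -/

section Elementary

variable {χ : Cardinal.{u}} {A : ZFSet.{u}} (hA : IsElemSubmodel A (H χ))
include hA

/-- Existential statements with parameters in `A ≺ H_χ` have witnesses in `A`. -/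
theorem IsElemSubmodel.exists_mem {α : Type} {P : (α → HType χ) → HType χ → Prop}
    (hP : FO fun w : Option α → HType χ => P (fun i => w (some i)) (w none))
    (v : α → HType χ) (hv : ∀ i, (v i).1 ∈ A) (hex : ∃ y, P v y) :
    ∃ y : HType χ, y.1 ∈ A ∧ P v y := by
  obtain ⟨S, hS⟩ := hA.2
  obtain ⟨φ, hφ⟩ := hP
  let ψ : setLanguage.Formula α :=
    Language.Formula.iExs Unit (φ.relabel fun i : Option α => i.elim (.inr ()) .inl)
  have key : ∀ (B : Type (u + 1)) [setLanguage.Structure B] (w : α → B),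
      ψ.Realize w ↔ ∃ y : B, φ.Realize fun i : Option α => i.elim y w := by
    intro B _ w
    rw [Language.Formula.realize_iExs]
    have hcomp : ∀ y : Unit → B, ((Sum.elim w y) ∘ fun i : Option α => i.elim (.inr ()) .inl) =
        fun i : Option α => i.elim (y ()) w := fun y => by
      funext i; cases i <;> rfl
    constructor
    · rintro ⟨y, hy⟩
      rw [Language.Formula.realize_relabel, hcomp] at hy
      exact ⟨_, hy⟩
    · rintro ⟨y, hy⟩
      refine ⟨fun _ => y, ?_⟩
      rw [Language.Formula.realize_relabel, hcomp]
      exact hy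
  let v' : α → S := fun i => ⟨v i, (hS _).2 (hv i)⟩
  obtain ⟨y, hy⟩ := hex
  have h1 : ψ.Realize v := (key _ v).2 ⟨y, (hφ _).2 hy⟩
  have h2 : ψ.Realize v' := (S.subtype.map_formula ψ v').1 h1
  obtain ⟨y, hy⟩ := (key _ v').1 h2
  refine ⟨y, (hS _).1 y.2, ?_⟩
  have h3 := (S.subtype.map_formula φ _).2 hy
  have h4 : (S.subtype ∘ fun i : Option α => i.elim y v') =
      fun i : Option α => i.elim (y : HType χ) v := by
    funext i; cases i <;> rfl
  rw [h4] at h3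
  exact (hφ _).1 h3

/-- Sets in `H_χ` that are definable from parameters in `A ≺ H_χ` belong to `A`. -/
theorem IsElemSubmodel.mem_of_definable (hχ : χ.IsRegular) {α : Type}
    {Q : (α → HType χ) → HType χ → Prop}
    (hQ : FO fun w : Option α → HType χ => Q (fun i => w (some i)) (w none))
    (v : α → HType χ) (hv : ∀ i, (v i).1 ∈ A) {Y : ZFSet.{u}} (hY : Y ∈ H χ)
    (h : ∀ z : HType χ, z.1 ∈ Y ↔ Q v z) : Y ∈ A := by
  have hP : FO fun w : Option α → HType χ =>
      ∀ z : HType χ, z.1 ∈ (w none).1 ↔ Q (fun i => w (some i)) z :=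
    FO.all (Q := fun w z => z.1 ∈ (w none).1 ↔ Q (fun i => w (some i)) z)
      (FO.iff FO.mem (hQ.relabel fun i : Option α => i.elim none fun j => some (some j)))
  obtain ⟨y, hy, hyQ⟩ := hA.exists_mem (P := fun v y => ∀ z : HType χ, z.1 ∈ y.1 ↔ Q v z)
    hP v hv ⟨⟨Y, hY⟩, h⟩
  have : Y = y.1 := by
    ext z
    constructor
    · intro hz
      exact (hyQ ⟨z, H_trans hχ hY hz⟩).2 ((h ⟨z, H_trans hχ hY hz⟩).1 hz)
    · intro hz
      exact (h ⟨z, H_trans hχ y.2 hz⟩).2 ((hyQ ⟨z, H_trans hχ y.2 hz⟩).1 hz)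
  rw [this]
  exact hy

end Elementary

section ElementaryClosure

variable {χ : Cardinal.{u}} (hχ : χ.IsRegular) {A : ZFSet.{u}} (hA : IsElemSubmodel A (H χ))
include hχ hA

theorem IsElemSubmodel.empty_mem : (∅ : ZFSet.{u}) ∈ A :=
  hA.mem_of_definable hχ (α := Empty) (Q := fun _ z => z.1 ∈ z.1) FO.mem (fun i => i.elim)
    (fun i => i.elim) (H_empty hχ)
    fun _ => ⟨fun h => (notMem_empty _ h).elim, fun h => (mem_irrefl _ h).elim⟩

theorem IsElemSubmodel.insert_mem {x y : ZFSet.{u}} (hx : x ∈ A) (hy : y ∈ A) : insert x y ∈ A :=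
  hA.mem_of_definable hχ (α := Fin 2) (Q := fun v z => z = v 0 ∨ z.1 ∈ (v 1).1)
    (FO.or FO.eq FO.mem) ![⟨x, hA.1 hx⟩, ⟨y, hA.1 hy⟩] (Fin.forall_fin_two.2 ⟨hx, hy⟩)
    (H_insert hχ (hA.1 hx) (hA.1 hy)) fun z => by simp [Subtype.ext_iff]

theorem IsElemSubmodel.singleton_mem {x : ZFSet.{u}} (hx : x ∈ A) : ({x} : ZFSet.{u}) ∈ A := by
  have h := hA.insert_mem hχ hx (hA.empty_mem hχ)
  simpa using h

theorem IsElemSubmodel.pair_mem {x y : ZFSet.{u}} (hx : x ∈ A) (hy : y ∈ A) : pair x y ∈ A :=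
  hA.insert_mem hχ (hA.singleton_mem hχ hx)
    (hA.singleton_mem hχ (hA.insert_mem hχ hx (hA.singleton_mem hχ hy)))

theorem IsElemSubmodel.mem_of_finite {x : ZFSet.{u}} (hfin : (x : Set ZFSet.{u}).Finite)
    (h : x ⊆ A) : x ∈ A := by
  have key : ∀ s : Set ZFSet.{u}, s.Finite → (∀ y ∈ s, y ∈ A) → ∃ y ∈ A, ∀ z, z ∈ y ↔ z ∈ s := by
    intro s hs
    induction s, hs using Set.Finite.induction_on with
    | empty => exact fun _ => ⟨∅, hA.empty_mem hχ, fun _ => by simp⟩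
    | insert _ _ ih =>
      intro hy
      obtain ⟨y, hyA, hys⟩ := ih fun y h => hy y (Set.mem_insert_of_mem _ h)
      exact ⟨_, hA.insert_mem hχ (hy _ (Set.mem_insert _ _)) hyA, fun z => by
        rw [mem_insert_iff, hys, Set.mem_insert_iff]⟩
  obtain ⟨y, hy, hyx⟩ := key _ hfin fun y hy => h hy
  have : x = y := by ext z; exact (hyx z).symm
  rwa [this]

theorem IsElemSubmodel.sUnion_mem {x : ZFSet.{u}} (hx : x ∈ A) : ZFSet.sUnion x ∈ A :=
  hA.mem_of_definable hχ (α := Unit) (Q := fun v z => ∃ y : HType χ, y.1 ∈ (v ()).1 ∧ z.1 ∈ y.1)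
    (FO.ex (FO.and FO.mem FO.mem)) (fun _ => ⟨x, hA.1 hx⟩) (fun _ => hx) (H_sUnion hχ (hA.1 hx))
    fun _ => by
      rw [mem_sUnion]
      exact ⟨fun ⟨y, hy, hz⟩ => ⟨⟨y, H_trans hχ (hA.1 hx) hy⟩, hy, hz⟩,
        fun ⟨y, hy, hz⟩ => ⟨y, hy, hz⟩⟩

/-- The value is definable through its elements, as `{z : ∃ y, (x, y) ∈ f ∧ z ∈ y}`. Only uniqueness
at `x` matters; `f` need not be a function elsewhere. -/
theorem IsElemSubmodel.apply_mem {f x y : ZFSet.{u}} (hf : f ∈ A) (hx : x ∈ A)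
    (hy : pair x y ∈ f) (hu : ∀ y', pair x y' ∈ f → y' = y) : y ∈ A :=
  hA.mem_of_definable hχ (α := Fin 2)
    (Q := fun v z => ∃ y : HType χ, pair (v 1).1 y.1 ∈ (v 0).1 ∧ z.1 ∈ y.1)
    (FO.ex (FO.and (FO.pair_mem hχ) FO.mem)) ![⟨f, hA.1 hf⟩, ⟨x, hA.1 hx⟩]
    (Fin.forall_fin_two.2 ⟨hf, hx⟩) (H_of_pair hχ (H_trans hχ (hA.1 hf) hy)).2 fun _ =>
      ⟨fun hz => ⟨⟨y, (H_of_pair hχ (H_trans hχ (hA.1 hf) hy)).2⟩, hy, hz⟩,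
        fun ⟨y', hy', hz⟩ => hu y'.1 hy' ▸ hz⟩

theorem IsElemSubmodel.fst_mem {x y : ZFSet.{u}} (h : pair x y ∈ A) : x ∈ A := by
  have hH := H_of_pair hχ (hA.1 h)
  refine hA.mem_of_definable hχ (α := Unit)
    (Q := fun v z => ∃ a b : HType χ, (v ()).1 = pair a.1 b.1 ∧ z.1 ∈ a.1)
    (FO.ex (FO.ex (FO.and (FO.eq_pair hχ) FO.mem))) (fun _ => ⟨_, hA.1 h⟩) (fun _ => h) hH.1
    fun z => ⟨fun hz => ⟨⟨x, hH.1⟩, ⟨y, hH.2⟩, rfl, hz⟩, ?_⟩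
  rintro ⟨a, b, hab, hz⟩
  rwa [(pair_inj.1 hab).1]

theorem IsElemSubmodel.snd_mem {x y : ZFSet.{u}} (h : pair x y ∈ A) : y ∈ A := by
  have hH := H_of_pair hχ (hA.1 h)
  refine hA.mem_of_definable hχ (α := Unit)
    (Q := fun v z => ∃ a b : HType χ, (v ()).1 = pair a.1 b.1 ∧ z.1 ∈ b.1)
    (FO.ex (FO.ex (FO.and (FO.eq_pair hχ) FO.mem))) (fun _ => ⟨_, hA.1 h⟩) (fun _ => h) hH.2
    fun z => ⟨fun hz => ⟨⟨x, hH.1⟩, ⟨y, hH.2⟩, rfl, hz⟩, ?_⟩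
  rintro ⟨a, b, hab, hz⟩
  rwa [(pair_inj.1 hab).2]

theorem IsElemSubmodel.prod_mem {x y : ZFSet.{u}} (hx : x ∈ A) (hy : y ∈ A) :
    ZFSet.prod x y ∈ A := by
  refine hA.mem_of_definable hχ (α := Fin 2)
    (Q := fun v z => ∃ a b : HType χ, a.1 ∈ (v 0).1 ∧ b.1 ∈ (v 1).1 ∧ z.1 = pair a.1 b.1)
    (FO.ex (FO.ex (FO.and FO.mem (FO.and FO.mem (FO.eq_pair hχ)))))
    ![⟨x, hA.1 hx⟩, ⟨y, hA.1 hy⟩] (Fin.forall_fin_two.2 ⟨hx, hy⟩)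
    (H_prod hχ (hA.1 hx) (hA.1 hy)) fun z => ?_
  rw [mem_prod]
  constructor
  · rintro ⟨a, ha, b, hb, hz⟩
    exact ⟨⟨a, H_trans hχ (hA.1 hx) ha⟩, ⟨b, H_trans hχ (hA.1 hy) hb⟩, ha, hb, hz⟩
  · rintro ⟨a, b, ha, hb, hz⟩
    exact ⟨a.1, ha, b.1, hb, hz⟩

/-! ### Hulls of elementary submodels -/

/-- The part of `f` over the points where it is single-valued is definable from `f` and is a
function. So being a function can be weakened to having a unique value at `x`. -/
theorem IsElemSubmodel.mem_Hull_iff {x y : ZFSet.{u}} : y ∈ Hull A x ↔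
    ∃ f ∈ A, pair x y ∈ f ∧ ∀ y', pair x y' ∈ f → y' = y := by
  rw [mem_Hull]
  simp only [exists_isFunc_iff]
  constructor
  · rintro ⟨f, hf, ⟨-, hu⟩, hxy⟩
    exact ⟨f, hf, hxy, fun y' hy' => hu _ _ _ hy' hxy⟩
  · rintro ⟨f, hf, hxy, hu⟩
    let g : ZFSet.{u} := ZFSet.sep
      (fun z => ∃ a b, z = pair a b ∧ ∀ b', pair a b' ∈ f → b' = b) f
    have hgH : g ∈ H χ := H_subset hχ (hA.1 hf) (sep_subset)
    refine ⟨g, ?_, ⟨?_, ?_⟩, ?_⟩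
    · refine hA.mem_of_definable hχ (α := Unit) (Q := fun v z => z.1 ∈ (v ()).1 ∧
        ∃ a b : HType χ, z.1 = pair a.1 b.1 ∧ ∀ b' : HType χ, pair a.1 b'.1 ∈ (v ()).1 → b' = b)
        (FO.and FO.mem (FO.ex (FO.ex (FO.and (FO.eq_pair hχ)
          (FO.all (FO.imp (FO.pair_mem hχ) FO.eq)))))) (fun _ => ⟨f, hA.1 hf⟩) (fun _ => hf) hgH
        fun z => ?_
      rw [mem_sep]
      refine and_congr_right fun hz => ?_
      constructor
      · rintro ⟨a, b, hab, h⟩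
        have hH := H_of_pair hχ (hab ▸ z.2)
        exact ⟨⟨a, hH.1⟩, ⟨b, hH.2⟩, hab, fun b' hb' => Subtype.ext (h _ hb')⟩
      · rintro ⟨a, b, hab, h⟩
        exact ⟨a.1, b.1, hab, fun b' hb' => congrArg Subtype.val
          (h ⟨b', (H_of_pair hχ (H_trans hχ (hA.1 hf) hb')).2⟩ hb')⟩
    · intro z hz
      obtain ⟨a, b, hab, -⟩ := (mem_sep.1 hz).2
      exact ⟨a, b, hab⟩
    · intro a b b' hb hb'
      obtain ⟨c, d, hcd, h⟩ := (mem_sep.1 hb').2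
      obtain ⟨rfl, rfl⟩ := pair_inj.1 hcd
      exact h b (mem_sep.1 hb).1
    · exact mem_sep.2 ⟨hxy, x, y, rfl, hu⟩

/-- Each `y ∈ A` is the value at `x` of the constant function `D × {y}`, which belongs to `A`. -/
theorem IsElemSubmodel.subset_Hull {D x : ZFSet.{u}} (hD : D ∈ A) (hx : x ∈ D) :
    A ⊆ Hull A x := fun _ hy =>
  (hA.mem_Hull_iff hχ).2 ⟨_, hA.prod_mem hχ hD (hA.singleton_mem hχ hy),
    pair_mem_prod.2 ⟨hx, mem_singleton.2 rfl⟩,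
    fun _ h => mem_singleton.1 (pair_mem_prod.1 h).2⟩

theorem IsElemSubmodel.Hull_subset {x : ZFSet.{u}} {B : ZFSet.{u}} (hAB : B ⊆ A) (hx : x ∈ A) :
    Hull B x ⊆ A := by
  intro y hy
  obtain ⟨f, hf, hfun, hxy⟩ := mem_Hull.1 hy
  exact hA.apply_mem hχ (hAB hf) hx hxy fun y' hy' =>
    (exists_isFunc_iff.1 hfun).2 _ _ _ hy' hxy

/-- The hull of an elementary submodel of `H_χ` is an elementary submodel of `H_χ`. -/
theorem IsElemSubmodel.Hull {D ξ : ZFSet.{u}} (hD : D ∈ A) (hξ : ξ ∈ D) :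
    IsElemSubmodel (Hull A ξ) (H χ) := by
  classical
  have hsub : NambaForcing.Hull A ξ ⊆ H χ := by
    intro y hy
    obtain ⟨f, hf, -, hxy⟩ := mem_Hull.1 hy
    exact (H_of_pair hχ (H_trans hχ (hA.1 hf) hxy)).2
  -- Tarski–Vaught test. The parameters are values `fᵢ(ξ)` with `fᵢ ∈ A`; the witness will be `g(ξ)`
  -- for a Skolem function `g ∈ A` on `D`.
  refine ⟨hsub, Language.Substructure.toElementarySubstructure
    ⟨{x | x.1 ∈ NambaForcing.Hull A ξ}, fun f => f.elim⟩ ?_, fun x => Iff.rfl⟩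
  intro n φ x a ha
  have hx : ∀ i, ∃ f ∈ A, pair ξ (x i).1.1 ∈ f ∧ ∀ y', pair ξ y' ∈ f → y' = (x i).1.1 :=
    fun i => (hA.mem_Hull_iff hχ).1 (x i).2
  choose f hfA hfx hfu using hx
  let v : Option (Fin n) → HType χ := fun i => i.elim ⟨D, hA.1 hD⟩ fun i => ⟨f i, hA.1 (hfA i)⟩
  have hP : FO fun w : Option (Option (Fin n)) → HType χ =>
      (∀ a b b' : HType χ, pair a.1 b.1 ∈ (w none).1 → pair a.1 b'.1 ∈ (w none).1 → b = b') ∧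
      ∀ c : HType χ, c.1 ∈ (w (some none)).1 → ∀ y : Fin n → HType χ,
        (∀ i, pair c.1 (y i).1 ∈ (w (some (some i))).1) →
        (∀ i, ∀ y' : HType χ, pair c.1 y'.1 ∈ (w (some (some i))).1 → y' = y i) →
        ∀ b : HType χ, φ.Realize default (Fin.snoc y b : Fin (n + 1) → HType χ) →
          ∃ b' : HType χ, pair c.1 b'.1 ∈ (w none).1 ∧
            φ.Realize default (Fin.snoc y b' : Fin (n + 1) → HType χ) := by
    have hφ : ∀ {γ : Type} (e : Fin n → γ) (j : γ), FO fun w : γ → HType χ =>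
        φ.Realize default (Fin.snoc (fun i => w (e i)) (w j) : Fin (n + 1) → HType χ) := by
      intro γ e j
      refine ((FO.realize φ).relabel (Fin.snoc e j : Fin (n + 1) → γ)).congr fun w => ?_
      refine iff_of_eq (congrArg _ (funext fun i => ?_))
      refine Fin.lastCases ?_ (fun i => ?_) i <;> simp
    refine FO.and (FO.all (FO.all (FO.all
      (FO.imp (FO.pair_mem hχ) (FO.imp (FO.pair_mem hχ) FO.eq))))) (FO.all (FO.imp FO.mem
      (FO.allFin (FO.imp (FO.forall_fin fun i => FO.pair_mem hχ)
      (FO.imp (FO.forall_fin fun i => FO.all (FO.imp (FO.pair_mem hχ) FO.eq))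
      (FO.all (FO.imp (hφ _ _) (FO.ex (FO.and (FO.pair_mem hχ) (hφ _ _))))))))))
  have key := hA.exists_mem
    (P := fun w g => (∀ a b b' : HType χ, pair a.1 b.1 ∈ g.1 → pair a.1 b'.1 ∈ g.1 → b = b') ∧
      ∀ c : HType χ, c.1 ∈ (w none).1 → ∀ y : Fin n → HType χ,
        (∀ i, pair c.1 (y i).1 ∈ (w (some i)).1) →
        (∀ i, ∀ y' : HType χ, pair c.1 y'.1 ∈ (w (some i)).1 → y' = y i) →
        ∀ b : HType χ, φ.Realize default (Fin.snoc y b : Fin (n + 1) → HType χ) →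
          ∃ b' : HType χ, pair c.1 b'.1 ∈ g.1 ∧
            φ.Realize default (Fin.snoc y b' : Fin (n + 1) → HType χ)) hP v
    (fun i => by cases i with
      | none => exact hD
      | some i => exact hfA i)
  -- A Skolem function exists in `H_χ`: a witness is chosen for each `c ∈ D` that has one, and
  -- replacement collects the choices because `D ∈ H_χ`. Elementarity then gives such a function in
  -- `A`.
  obtain ⟨g, hgA, hg⟩ := key (by
    let R : ZFSet.{u} → HType χ → Prop := fun c b => ∃ y : Fin n → HType χ,
      (∀ i, pair c (y i).1 ∈ f i) ∧ (∀ i, ∀ y' : HType χ, pair c y'.1 ∈ f i → y' = y i) ∧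
        φ.Realize default (Fin.snoc y b : Fin (n + 1) → HType χ)
    let F : ZFSet.{u} → ZFSet.{u} := fun c =>
      if h : ∃ b, R c b then pair c h.choose.1 else ∅
    obtain ⟨G, hG, hGF⟩ := H_replacement hχ (hA.1 hD) F (fun c hc => by
      by_cases h : ∃ b, R c b
      · simp only [F, dif_pos h]
        exact H_pair hχ (H_trans hχ (hA.1 hD) hc) h.choose.2
      · simp only [F, dif_neg h]
        exact H_empty hχ)
    have hpair : ∀ c b, pair c b ∈ G → ∃ h : ∃ b, R c b, h.choose.1 = b := by
      intro c b hcb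
      obtain ⟨d, -, hd⟩ := (hGF _).1 hcb
      by_cases h : ∃ b, R d b
      · simp only [F, dif_pos h] at hd
        obtain ⟨rfl, h2⟩ := pair_inj.1 hd
        exact ⟨h, h2⟩
      · simp only [F, dif_neg h] at hd
        exact absurd hd.symm (by
          intro h0
          have : ({c} : ZFSet.{u}) ∈ pair c b := by simp [pair]
          rw [h0] at this
          exact notMem_empty _ this)
    refine ⟨⟨G, hG⟩, fun c b b' hb hb' => ?_, fun c hc y hy hyu b hb => ?_⟩
    · obtain ⟨h, h1⟩ := hpair _ _ hb
      obtain ⟨_, h2⟩ := hpair _ _ hb'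
      exact Subtype.ext (h1.symm.trans h2)
    · have h : ∃ b, R c.1 b := ⟨b, y, hy, hyu, hb⟩
      obtain ⟨y', hy', -, hφ⟩ := h.choose_spec
      refine ⟨h.choose, (hGF _).2 ⟨c.1, hc, by simp only [F, dif_pos h]⟩, ?_⟩
      have : y' = y := funext fun i => hyu i _ (hy' i)
      rwa [this] at hφ)
  obtain ⟨b', hb', hφ⟩ := hg.2 ⟨ξ, H_trans hχ (hA.1 hD) hξ⟩ hξ (fun i => (x i).1) hfx
    (fun i y' h => Subtype.ext (hfu i y'.1 h)) a ha
  refine ⟨⟨b', (hA.mem_Hull_iff hχ).2 ⟨g.1, hgA, hb', fun y' hy' => ?_⟩⟩, hφ⟩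
  exact congrArg Subtype.val
    (hg.1 ⟨ξ, H_trans hχ (hA.1 hD) hξ⟩ ⟨y', (H_of_pair hχ (H_trans hχ g.2 hy')).2⟩ b' hy' hb')

/-! ### Countable sets in elementary submodels -/

theorem IsElemSubmodel.nat_mem (n : ℕ) : Ordinal.toZFSet (n : Ordinal.{u}) ∈ A := by
  induction n with
  | zero => simpa using hA.empty_mem hχ
  | succ n ih =>
    rw [Nat.cast_succ, Ordinal.toZFSet_add_one]
    exact hA.insert_mem hχ ih ih

omit hA in
theorem H_nat (n : ℕ) : Ordinal.toZFSet (n : Ordinal.{u}) ∈ H χ := by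
  induction n with
  | zero => simpa using H_empty hχ
  | succ n ih =>
    rw [Nat.cast_succ, Ordinal.toZFSet_add_one]
    exact H_insert hχ ih ih

omit hχ hA in
theorem mem_toZFSet_omega0 {x : ZFSet.{u}} :
    x ∈ Ordinal.omega0.toZFSet ↔ ∃ n : ℕ, Ordinal.toZFSet (n : Ordinal.{u}) = x := by
  rw [Ordinal.mem_toZFSet_iff]
  constructor
  · rintro ⟨a, ha, rfl⟩
    obtain ⟨n, rfl⟩ := Ordinal.lt_omega0.1 ha
    exact ⟨n, rfl⟩
  · rintro ⟨n, rfl⟩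
    exact ⟨n, Ordinal.natCast_lt_omega0 n, rfl⟩

theorem IsElemSubmodel.omega0_mem (hω : ℵ₀ < χ) : Ordinal.omega0.toZFSet ∈ A := by
  have hH : Ordinal.omega0.toZFSet ∈ H χ := by
    refine (mem_H_iff hχ).2 ⟨by simpa [Ordinal.card_toZFSet] using hω, fun y hy => ?_⟩
    obtain ⟨n, rfl⟩ := mem_toZFSet_omega0.1 hy
    exact H_nat hχ n
  -- `ω` is defined without parameters as the intersection of all inductive sets in `H_χ`.
  refine hA.mem_of_definable hχ (α := Empty) (Q := fun _ z => ∀ w : HType χ,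
    (∀ e : HType χ, (∀ t : HType χ, ¬ t.1 ∈ e.1) → e.1 ∈ w.1) →
    (∀ n m : HType χ, n.1 ∈ w.1 → (∀ t : HType χ, t.1 ∈ m.1 ↔ t = n ∨ t.1 ∈ n.1) → m.1 ∈ w.1) →
    z.1 ∈ w.1)
    (FO.all (FO.imp (FO.all (FO.imp (FO.all (FO.not FO.mem)) FO.mem)) (FO.imp (FO.all (FO.all
      (FO.imp FO.mem (FO.imp (FO.all (FO.iff FO.mem (FO.or FO.eq FO.mem))) FO.mem)))) FO.mem)))
    (fun i => i.elim) (fun i => i.elim) hH fun z => ?_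
  rw [mem_toZFSet_omega0]
  constructor
  · rintro ⟨n, hn⟩ w h0 hs
    rw [← hn]
    clear hn
    induction n with
    | zero => exact h0 ⟨_, H_nat hχ 0⟩ fun t => by simp
    | succ n ih =>
      refine hs ⟨_, H_nat hχ n⟩ ⟨_, H_nat hχ (n + 1)⟩ ih fun t => ?_
      change t.1 ∈ Ordinal.toZFSet ((n + 1 : ℕ) : Ordinal) ↔ _
      rw [Nat.cast_succ, Ordinal.toZFSet_add_one, mem_insert_iff, Subtype.ext_iff]
  · intro h
    refine mem_toZFSet_omega0.1 (h ⟨_, hH⟩ (fun e he => ?_) fun n m hn hm => ?_)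
    · refine mem_toZFSet_omega0.2 ⟨0, ?_⟩
      rw [Nat.cast_zero, Ordinal.toZFSet_zero]
      exact ((eq_empty _).2 fun y hy => he ⟨y, H_trans hχ e.2 hy⟩ hy).symm
    · obtain ⟨k, hk⟩ := mem_toZFSet_omega0.1 hn
      refine mem_toZFSet_omega0.2 ⟨k + 1, ?_⟩
      rw [Nat.cast_succ, Ordinal.toZFSet_add_one, hk]
      ext y
      rw [mem_insert_iff]
      constructor
      · rintro (rfl | hy)
        · exact (hm n).2 (.inl rfl)
        · exact (hm ⟨y, H_trans hχ n.2 hy⟩).2 (.inr hy)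
      · intro hy
        exact ((hm ⟨y, H_trans hχ m.2 hy⟩).1 hy).imp (congrArg Subtype.val) id

/-- By elementarity `A` contains a single-valued relation that covers `x` by values at natural
numbers. All natural numbers are in `A`, hence so are these values. -/
theorem IsElemSubmodel.subset_of_countable (hω : ℵ₀ < χ) {x : ZFSet.{u}} (hx : x ∈ A)
    (hc : x.card ≤ ℵ₀) : x ⊆ A := by
  have hωA := hA.omega0_mem hχ hω
  have hcount : Countable x := by
    rw [← Cardinal.mk_le_aleph0_iff, cardinalMk_coe_sort, Cardinal.lift_le_aleph0]
    exact hc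
  rcases isEmpty_or_nonempty x with he | hne
  · intro y hy
    exact (he.false ⟨y, hy⟩).elim
  obtain ⟨e, he⟩ := exists_surjective_nat x
  have hinj : Function.Injective fun n : ℕ => Ordinal.toZFSet (n : Ordinal.{u}) :=
    fun m n h => Nat.cast_injective (Ordinal.toZFSet_injective h)
  let f : ZFSet.{u} := ZFSet.range fun n : ULift.{u} ℕ =>
    pair (Ordinal.toZFSet (n.down : Ordinal.{u})) (e n.down).1
  have hmem : ∀ a b, pair a b ∈ f ↔ ∃ n : ℕ, Ordinal.toZFSet (n : Ordinal.{u}) = a ∧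
      (e n).1 = b := by
    intro a b
    simp only [f, mem_range, pair_inj]
    exact ⟨fun ⟨n, h⟩ => ⟨n.down, h⟩, fun ⟨n, h⟩ => ⟨⟨n⟩, h⟩⟩
  have hfH : f ∈ H χ := H_range hχ _ (by simpa using hω)
    fun n => H_pair hχ (H_nat hχ _) (H_trans hχ (hA.1 hx) (e n.down).2)
  obtain ⟨g, hgA, hg1, hg2⟩ := hA.exists_mem (α := Fin 2) (P := fun v f =>
    (∀ a b b' : HType χ, pair a.1 b.1 ∈ f.1 → pair a.1 b'.1 ∈ f.1 → b = b') ∧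
    ∀ y : HType χ, y.1 ∈ (v 0).1 → ∃ n : HType χ, n.1 ∈ (v 1).1 ∧ pair n.1 y.1 ∈ f.1)
    (FO.and (FO.all (FO.all (FO.all (FO.imp (FO.pair_mem hχ) (FO.imp (FO.pair_mem hχ) FO.eq)))))
      (FO.all (FO.imp FO.mem (FO.ex (FO.and FO.mem (FO.pair_mem hχ))))))
    ![⟨x, hA.1 hx⟩, ⟨_, hA.1 hωA⟩] (Fin.forall_fin_two.2 ⟨hx, hωA⟩) ⟨⟨f, hfH⟩, by
      intro a b b' hb hb'
      obtain ⟨n, hn, hnb⟩ := (hmem _ _).1 hb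
      obtain ⟨m, hm, hmb⟩ := (hmem _ _).1 hb'
      obtain rfl := hinj (hn.trans hm.symm)
      exact Subtype.ext (hnb.symm.trans hmb), by
      intro y hy
      obtain ⟨n, hn⟩ := he ⟨y.1, hy⟩
      exact ⟨⟨_, H_nat hχ n⟩, mem_toZFSet_omega0.2 ⟨n, rfl⟩, (hmem _ _).2 ⟨n, rfl, by rw [hn]⟩⟩⟩
  intro y hy
  have hyH := H_trans hχ (hA.1 hx) hy
  obtain ⟨n, hn, hny⟩ := hg2 ⟨y, hyH⟩ hy
  obtain ⟨k, hk⟩ := mem_toZFSet_omega0.1 hn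
  exact hA.apply_mem hχ hgA (hk ▸ hA.nat_mem hχ k) hny fun y' hy' => congrArg Subtype.val
    (hg1 n ⟨y', (H_of_pair hχ (H_trans hχ g.2 hy')).2⟩ ⟨y, hyH⟩ hy' hny)

end ElementaryClosure

/-! ### Countable ordinals of elementary submodels -/

theorem mem_omega1_iff {x : ZFSet.{u}} : x ∈ omega1 ↔ x.IsOrdinal ∧ x.card ≤ ℵ₀ := by
  rw [omega1, Ordinal.mem_toZFSet_iff]
  constructor
  · rintro ⟨a, ha, rfl⟩
    refine ⟨isOrdinal_toZFSet a, ?_⟩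
    rwa [Ordinal.card_toZFSet, ← lt_aleph_one_iff, ← lt_ord]
  · rintro ⟨ho, hc⟩
    refine ⟨x.rank, ?_, ho.toZFSet_rank_eq⟩
    rwa [lt_ord, ← Ordinal.card_toZFSet, ho.toZFSet_rank_eq, lt_aleph_one_iff]

theorem omega1_isOrdinal : omega1.{u}.IsOrdinal := isOrdinal_toZFSet _

section CountableOrdinals

variable {χ : Cardinal.{u}} (hχ : χ.IsRegular) (hω : ℵ₀ < χ) {M : ZFSet.{u}}
  (hM : IsElemSubmodel M (H χ))
include hχ hω

theorem omega1_subset_H : omega1.{u} ⊆ H χ := by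
  intro x
  induction x using ZFSet.inductionOn with
  | _ x ih =>
    intro hx
    exact (mem_H_iff hχ).2 ⟨(mem_omega1_iff.1 hx).2.trans_lt hω,
      fun y hy => ih y hy (omega1_isOrdinal.mem_trans hy hx)⟩

theorem H_of_countable {x : ZFSet.{u}} (hc : x.card ≤ ℵ₀) (h : x ⊆ H χ) : x ∈ H χ :=
  (mem_H_iff hχ).2 ⟨hc.trans_lt hω, fun _ hy => h hy⟩

include hM

theorem IsElemSubmodel.inter_omega1_isOrdinal : (M ∩ omega1).IsOrdinal := by
  rw [isOrdinal_iff_forall_mem_isOrdinal]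
  refine ⟨fun y hy z hz => ?_, fun y hy => (mem_omega1_iff.1 (mem_inter.1 hy).2).1⟩
  obtain ⟨hyM, hy1⟩ := mem_inter.1 hy
  exact mem_inter.2 ⟨hM.subset_of_countable hχ hω hyM (mem_omega1_iff.1 hy1).2 hz,
    omega1_isOrdinal.mem_trans hz hy1⟩

theorem IsElemSubmodel.inter_omega1_mem_omega1 (hc : M.card ≤ ℵ₀) : M ∩ omega1 ∈ omega1 :=
  mem_omega1_iff.2 ⟨hM.inter_omega1_isOrdinal hχ hω,
    (card_mono fun _ h => (mem_inter.1 h).1).trans hc⟩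

/-- A countable `M ≺ H_χ` that is an element of `A ≺ H_χ` satisfies `M ∩ ω₁ ∈ A`. -/
theorem IsElemSubmodel.inter_omega1_mem {A : ZFSet.{u}} (hA : IsElemSubmodel A (H χ))
    (hc : M.card ≤ ℵ₀) (hMA : M ∈ A) : M ∩ omega1 ∈ A := by
  -- The definition must avoid `ω₁`, which need not be in `H_χ`. The countable ordinals of `M` are
  -- the transitive `z ∈ M` with transitive elements and `z ⊆ M`; the last clause gives countability
  -- because `M` is countable.
  refine hA.mem_of_definable hχ (α := Unit) (Q := fun v z => z.1 ∈ (v ()).1 ∧ z.1 ⊆ (v ()).1 ∧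
    (∀ x : HType χ, x.1 ∈ z.1 → x.1 ⊆ z.1) ∧
      ∀ x y w : HType χ, x.1 ∈ y.1 → y.1 ∈ w.1 → w.1 ∈ z.1 → x.1 ∈ w.1)
    (FO.and FO.mem (FO.and (FO.subset hχ) (FO.and (FO.all (FO.imp FO.mem (FO.subset hχ)))
      (FO.all (FO.all (FO.all (FO.imp FO.mem (FO.imp FO.mem (FO.imp FO.mem FO.mem)))))))))
    (fun _ => ⟨M, hA.1 hMA⟩) (fun _ => hMA)
    (H_subset hχ (hA.1 hMA) fun _ h => (mem_inter.1 h).1) fun z => ?_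
  rw [mem_inter]
  refine and_congr_right fun hz => ⟨fun h => ?_, fun ⟨hzM, h1, h2⟩ => ?_⟩
  · obtain ⟨ho, hzc⟩ := mem_omega1_iff.1 h
    exact ⟨hM.subset_of_countable hχ hω hz hzc, fun x hx => ho.subset_of_mem hx,
      fun x y w hxy hyw hwz => (ho.mem hwz).mem_trans hxy hyw⟩
  · refine mem_omega1_iff.2 ⟨⟨fun x hx => h1 ⟨x, H_trans hχ z.2 hx⟩ hx, ?_⟩,
      (card_mono hzM).trans hc⟩
    intro x y w hxy hyw hwz
    have hw := H_trans hχ z.2 hwz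
    have hy := H_trans hχ hw hyw
    exact h2 ⟨x, H_trans hχ hy hxy⟩ ⟨y, hy⟩ ⟨w, hw⟩ hxy hyw hwz

end CountableOrdinals

/-! ### Codes of finite sequences, runs and triples -/

theorem mem_seqCode {l : List ZFSet.{u}} {x : ZFSet.{u}} : x ∈ seqCode l ↔
    ∃ i : Fin l.length, pair (Ordinal.toZFSet ((i : ℕ) : Ordinal.{u})) (l.get i) = x := by
  rw [seqCode, mem_range]

theorem pair_mem_seqCode {l : List ZFSet.{u}} {n : ℕ} {x : ZFSet.{u}} :
    pair (Ordinal.toZFSet (n : Ordinal.{u})) x ∈ seqCode l ↔ l[n]? = some x := by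
  rw [mem_seqCode, List.getElem?_eq_some_iff]
  constructor
  · rintro ⟨i, hi⟩
    obtain ⟨h1, h2⟩ := pair_inj.1 hi
    have h3 : (i : ℕ) = n := Nat.cast_injective (Ordinal.toZFSet_injective h1)
    subst h3
    exact ⟨i.2, h2⟩
  · rintro ⟨h, rfl⟩
    exact ⟨⟨n, h⟩, rfl⟩

theorem seqCode_injective : Function.Injective seqCode.{u} := by
  intro l l' h
  refine List.ext_getElem? fun n => Option.ext fun x => ?_
  rw [← pair_mem_seqCode, ← pair_mem_seqCode, h]

theorem finite_seqCode (l : List ZFSet.{u}) : (seqCode l : Set ZFSet.{u}).Finite := by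
  rw [seqCode, coe_range]
  exact Set.finite_range _

theorem Round.code_injective : Function.Injective Round.code.{u} := by
  rintro ⟨a, b, c⟩ ⟨a', b', c'⟩ h
  obtain ⟨h1, h2⟩ := pair_inj.1 h
  obtain ⟨h3, h4⟩ := pair_inj.1 h1
  simp only at h2 h3 h4
  rw [h2, h3, h4]

theorem runCode_injective : Function.Injective runCode.{u} :=
  seqCode_injective.comp (List.map_injective_iff.2 Round.code_injective)

theorem triple_inj {M M' : ZFSet.{u}} {r r' : List Round.{u}} {S S' : ZFSet.{u}} :
    triple M r S = triple M' r' S' ↔ M = M' ∧ r = r' ∧ S = S' := by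
  rw [triple, triple, pair_inj, pair_inj, runCode_injective.eq_iff]

theorem card_le_aleph0_of_finite {x : ZFSet.{u}} (h : (x : Set ZFSet.{u}).Finite) :
    x.card ≤ ℵ₀ := by
  have : Finite x := h.to_subtype
  rw [← Cardinal.lift_le_aleph0.{u, u + 1}, ← cardinalMk_coe_sort]
  exact Cardinal.mk_le_aleph0

section Codes

variable {χ : Cardinal.{u}} (hχ : χ.IsRegular)
include hχ

theorem H_seqCode {l : List ZFSet.{u}} (h : ∀ m ∈ l, m ∈ H χ) : seqCode l ∈ H χ := by
  refine H_of_finite hχ (finite_seqCode l) fun x hx => ?_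
  obtain ⟨i, rfl⟩ := mem_seqCode.1 hx
  exact H_pair hχ (H_nat hχ _) (h _ (List.get_mem l i))

variable {A : ZFSet.{u}} (hA : IsElemSubmodel A (H χ)) (hω : ℵ₀ < χ)
include hA hω

theorem IsElemSubmodel.subset_of_finite {x : ZFSet.{u}} (hx : x ∈ A)
    (h : (x : Set ZFSet.{u}).Finite) : x ⊆ A :=
  hA.subset_of_countable hχ hω hx (card_le_aleph0_of_finite h)

theorem IsElemSubmodel.ξ_mem_of_runCode_mem {r : List Round.{u}} (hr : runCode r ∈ A) :
    ∀ t ∈ r, t.ξ ∈ A := by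
  intro t ht
  obtain ⟨n, hn⟩ := List.mem_iff_getElem?.1 (List.mem_map_of_mem (f := Round.code) ht)
  exact hA.snd_mem hχ (hA.snd_mem hχ
    (hA.subset_of_finite hχ hω hr (finite_seqCode _) (pair_mem_seqCode.2 hn)))

omit hω in
theorem IsElemSubmodel.model_subset {r : List Round.{u}} (hr : ∀ t ∈ r, t.ξ ∈ A) :
    ∀ {B : ZFSet.{u}}, B ⊆ A → model B r ⊆ A := by
  induction r with
  | nil => exact fun h => h
  | cons t r ih =>
    intro B hB
    exact ih (fun s hs => hr s (List.mem_cons_of_mem _ hs))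
      (hA.Hull_subset hχ hB (hr t List.mem_cons_self))

/-- If a triple `(M, r, S)` with `M` countable belongs to `A ≺ H_χ`, then `M ⋉ r ⊆ A`. -/
theorem IsElemSubmodel.model_subset_of_triple_mem {M S : ZFSet.{u}} {r : List Round.{u}}
    (hM : M.card ≤ ℵ₀) (h : triple M r S ∈ A) : model M r ⊆ A :=
  hA.model_subset hχ (hA.ξ_mem_of_runCode_mem hχ hω (hA.fst_mem hχ (hA.snd_mem hχ h)))
    (hA.subset_of_countable hχ hω (hA.fst_mem hχ h) hM)

end Codes

/-! ### Models along runs -/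

theorem Hull_mono {A B x : ZFSet.{u}} (h : B ⊆ A) : Hull B x ⊆ Hull A x := by
  intro y hy
  rw [mem_Hull] at hy ⊢
  obtain ⟨f, hf, hy⟩ := hy
  exact ⟨f, h hf, hy⟩

theorem model_inter_omega1 {K : ZFSet.{u}} {r : List Round.{u}} :
    ∀ {M : ZFSet.{u}}, IsRun K M r → model M r ∩ omega1 = M ∩ omega1 := by
  induction r with
  | nil => exact fun _ => rfl
  | cons t r ih => exact fun h => (ih h.2.2).trans h.2.1.2.2

/-- In each round `κ` lies in the smaller model, hence in the larger one, and serves there as the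
set in which `ξ` is found. The run has to be legal for `B` only, so the lemma applies to `N` along a
run on `N ∩ H_μ`. -/
theorem IsElemSubmodel.model {χ : Cardinal.{u}} (hχ : χ.IsRegular) {K : ZFSet.{u}}
    {r : List Round.{u}} : ∀ {A B : ZFSet.{u}}, IsElemSubmodel A (H χ) → B ⊆ A → IsRun K B r →
      IsElemSubmodel (model A r) (H χ) ∧ A ⊆ model A r ∧ NambaForcing.model B r ⊆ model A r := by
  induction r with
  | nil => exact fun hA hB _ => ⟨hA, fun _ h => h, hB⟩
  | cons t r ih =>
    intro A B hA hB hr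
    have hκ := hB hr.1.2.1
    obtain ⟨h1, h2, h3⟩ := ih (hA.Hull hχ hκ hr.2.1.1) (Hull_mono hB) hr.2.2
    exact ⟨h1, fun x hx => h2 (hA.subset_Hull hχ hκ hr.2.1.1 hx), h3⟩

/-! ### Currying, and reflection of functions from `N` to `N ∩ H_μ` -/

section Currying

variable {χ : Cardinal.{u}} (hχ : χ.IsRegular) {A : ZFSet.{u}} (hA : IsElemSubmodel A (H χ))
include hχ hA

/-- Uncurrying: a function `f` whose values are functions gives a function of pairs. -/
theorem IsElemSubmodel.exists_uncurry {f L D X : ZFSet.{u}} (hf : f ∈ A) (hL : L ∈ A)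
    (hD : D ∈ A) (hX : X ∈ A) : ∃ F ∈ A, F ⊆ ZFSet.prod (ZFSet.prod L D) X ∧
      ∀ a v y, pair (pair a v) y ∈ F ↔ a ∈ L ∧ v ∈ D ∧ y ∈ X ∧ ∃ g, pair a g ∈ f ∧
        (∀ g', pair a g' ∈ f → g' = g) ∧ pair v y ∈ g ∧ ∀ y', pair v y' ∈ g → y' = y := by
  have hP : ZFSet.prod (ZFSet.prod L D) X ∈ A := hA.prod_mem hχ (hA.prod_mem hχ hL hD) hX
  refine ⟨ZFSet.sep (fun z => ∃ a v y, z = pair (pair a v) y ∧ ∃ g, pair a g ∈ f ∧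
    (∀ g', pair a g' ∈ f → g' = g) ∧ pair v y ∈ g ∧ ∀ y', pair v y' ∈ g → y' = y)
    (ZFSet.prod (ZFSet.prod L D) X), ?_, sep_subset, fun a v y => ?_⟩
  · refine hA.mem_of_definable hχ (α := Fin 2) (Q := fun w z => z.1 ∈ (w 1).1 ∧
      ∃ a v y p : HType χ, p.1 = pair a.1 v.1 ∧ z.1 = pair p.1 y.1 ∧ ∃ g : HType χ,
        pair a.1 g.1 ∈ (w 0).1 ∧ (∀ g' : HType χ, pair a.1 g'.1 ∈ (w 0).1 → g' = g) ∧
          pair v.1 y.1 ∈ g.1 ∧ ∀ y' : HType χ, pair v.1 y'.1 ∈ g.1 → y' = y)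
      (FO.and FO.mem (FO.ex (FO.ex (FO.ex (FO.ex (FO.and (FO.eq_pair hχ) (FO.and (FO.eq_pair hχ)
        (FO.ex (FO.and (FO.pair_mem hχ) (FO.and
          (FO.all (FO.imp (FO.pair_mem hχ) FO.eq)) (FO.and (FO.pair_mem hχ)
            (FO.all (FO.imp (FO.pair_mem hχ) FO.eq)))))))))))))
      ![⟨f, hA.1 hf⟩, ⟨_, hA.1 hP⟩] (Fin.forall_fin_two.2 ⟨hf, hP⟩)
      (H_subset hχ (hA.1 hP) sep_subset) fun z => ?_
    rw [mem_sep]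
    refine and_congr_right fun hz => ?_
    constructor
    · rintro ⟨a, v, y, hzp, g', hg', hu, hvy, hy⟩
      have h1 := H_of_pair hχ (hzp ▸ z.2)
      have h2 := H_of_pair hχ h1.1
      exact ⟨⟨a, h2.1⟩, ⟨v, h2.2⟩, ⟨y, h1.2⟩, ⟨_, h1.1⟩, rfl, hzp,
        ⟨g', (H_of_pair hχ (H_trans hχ (hA.1 hf) hg')).2⟩, hg',
        fun g'' h => Subtype.ext (hu _ h), hvy, fun y' h => Subtype.ext (hy _ h)⟩
    · rintro ⟨a, v, y, p, hp, hzp, g', hg', hu, hvy, hy⟩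
      refine ⟨a.1, v.1, y.1, hp ▸ hzp, g'.1, hg', fun g'' h => ?_, hvy, fun y' h => ?_⟩
      · exact congrArg Subtype.val
          (hu ⟨g'', (H_of_pair hχ (H_trans hχ (hA.1 hf) h)).2⟩ h)
      · exact congrArg Subtype.val (hy ⟨y', (H_of_pair hχ (H_trans hχ g'.2 h)).2⟩ h)
  · rw [mem_sep, pair_mem_prod, pair_mem_prod]
    constructor
    · rintro ⟨⟨⟨ha, hv⟩, hy⟩, a', v', y', heq, h⟩
      obtain ⟨h1, rfl⟩ := pair_inj.1 heq
      obtain ⟨rfl, rfl⟩ := pair_inj.1 h1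
      exact ⟨ha, hv, hy, h⟩
    · rintro ⟨ha, hv, hy, h⟩
      exact ⟨⟨⟨ha, hv⟩, hy⟩, a, v, y, rfl, h⟩

/-- Currying: a relation `F` on pairs gives the function `a ↦ {(v, y) : ((a, v), y) ∈ F}`. -/
theorem IsElemSubmodel.exists_curry {L F : ZFSet.{u}} (hL : L ∈ A) (hF : F ∈ A) :
    ∃ k ∈ A, ∀ a ∈ L, ∃ b, pair a b ∈ k ∧ (∀ b', pair a b' ∈ k → b' = b) ∧
      ∀ e, e ∈ b ↔ ∃ v y, e = pair v y ∧ pair (pair a v) y ∈ F := by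
  let U : ZFSet.{u} := ZFSet.sUnion (ZFSet.sUnion F)
  have hU : U ∈ H χ := H_sUnion hχ (H_sUnion hχ (hA.1 hF))
  have hU' : ZFSet.sUnion (ZFSet.sUnion U) ∈ H χ := H_sUnion hχ (H_sUnion hχ hU)
  let G : ZFSet.{u} → ZFSet.{u} := fun a => ZFSet.sep
    (fun w => ∃ v y, w = pair v y ∧ pair (pair a v) y ∈ F)
    (ZFSet.prod (ZFSet.sUnion (ZFSet.sUnion U)) U)
  have hGH : ∀ a, G a ∈ H χ := fun a => H_subset hχ (H_prod hχ hU' hU) sep_subset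
  have hG : ∀ a e, e ∈ G a ↔ ∃ v y, e = pair v y ∧ pair (pair a v) y ∈ F := by
    intro a e
    rw [mem_sep]
    refine ⟨fun h => h.2, fun h => ⟨?_, h⟩⟩
    obtain ⟨v, y, rfl, h⟩ := h
    exact pair_mem_prod.2 ⟨snd_mem_sUnion_sUnion (fst_mem_sUnion_sUnion h),
      snd_mem_sUnion_sUnion h⟩
  obtain ⟨k, hkH, hk⟩ := H_replacement hχ (hA.1 hL) (fun a => pair a (G a))
    fun a ha => H_pair hχ (H_trans hχ (hA.1 hL) ha) (hGH a)
  refine ⟨k, ?_, fun a ha => ⟨G a, (hk _).2 ⟨a, ha, rfl⟩, fun b' hb' => ?_, hG a⟩⟩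
  · refine hA.mem_of_definable hχ (α := Fin 2) (Q := fun w z => ∃ a b : HType χ,
      a.1 ∈ (w 0).1 ∧ z.1 = pair a.1 b.1 ∧ ∀ e : HType χ, e.1 ∈ b.1 ↔
        ∃ v y p : HType χ, e.1 = pair v.1 y.1 ∧ p.1 = pair a.1 v.1 ∧ pair p.1 y.1 ∈ (w 1).1)
      (FO.ex (FO.ex (FO.and FO.mem (FO.and (FO.eq_pair hχ) (FO.all (FO.iff FO.mem
        (FO.ex (FO.ex (FO.ex (FO.and (FO.eq_pair hχ) (FO.and (FO.eq_pair hχ)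
          (FO.pair_mem hχ))))))))))))
      ![⟨L, hA.1 hL⟩, ⟨F, hA.1 hF⟩] (Fin.forall_fin_two.2 ⟨hL, hF⟩) hkH fun z => ?_
    have hGe : ∀ a : HType χ, ∀ e : HType χ, e.1 ∈ G a.1 ↔ ∃ v y p : HType χ,
        e.1 = pair v.1 y.1 ∧ p.1 = pair a.1 v.1 ∧ pair p.1 y.1 ∈ F := by
      intro a e
      rw [hG]
      constructor
      · rintro ⟨v, y, hvy, h⟩
        have h1 := H_of_pair hχ (hvy ▸ e.2)
        exact ⟨⟨v, h1.1⟩, ⟨y, h1.2⟩, ⟨_, H_pair hχ a.2 h1.1⟩, hvy, rfl, h⟩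
      · rintro ⟨v, y, p, he, hp, h⟩
        exact ⟨v.1, y.1, he, hp ▸ h⟩
    rw [hk]
    constructor
    · rintro ⟨a, ha, hz⟩
      have haH := H_trans hχ (hA.1 hL) ha
      exact ⟨⟨a, haH⟩, ⟨G a, hGH a⟩, ha, hz.symm, hGe ⟨a, haH⟩⟩
    · rintro ⟨a, b, ha, hz, hb⟩
      refine ⟨a.1, ha, ?_⟩
      have : G a.1 = b.1 := by
        ext e
        constructor
        · intro he
          exact (hb ⟨e, H_trans hχ (hGH _) he⟩).2 ((hGe a ⟨e, H_trans hχ (hGH _) he⟩).1 he)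
        · intro he
          exact (hGe a ⟨e, H_trans hχ b.2 he⟩).2 ((hb ⟨e, H_trans hχ b.2 he⟩).1 he)
      rw [this, hz]
  · obtain ⟨a', -, ha'⟩ := (hk _).1 hb'
    obtain ⟨rfl, rfl⟩ := pair_inj.1 ha'
    rfl

end Currying

/-- Every single-valued relation in `A` with domain included in an element of `C` and values in
`X` belongs to `B`. -/
def RelationsReflect (A B C X : ZFSet.{u}) : Prop :=
  ∀ D ∈ C, ∀ g ∈ A, g ⊆ ZFSet.prod D X →
    (∀ a b b', pair a b ∈ g → pair a b' ∈ g → b = b') → g ∈ B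

section Reflect

variable {μ θ : Cardinal.{u}} (hμ : μ.IsRegular) (hθ : θ.IsRegular) {C X : ZFSet.{u}}
  (hC : IsElemSubmodel C (H μ))
include hμ hθ hC

/-- If `g = f(ξ)` with `f ∈ A`, uncurrying turns `f` into a partial function `F ∈ A` from `L × D` to
`X`. The hypothesis gives `F ∈ B`, and currying back inside `B` gives `g ∈ Hull(B, ξ)`. The
collection `C` of domains stays fixed since it is closed under products. -/
theorem RelationsReflect.Hull {A B L ξ : ZFSet.{u}} (h : RelationsReflect A B C X)
    (hA : IsElemSubmodel A (H θ)) (hB : IsElemSubmodel B (H μ)) (hBA : B ⊆ A) (hCB : C ⊆ B)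
    (hX : X ∈ A) (hL : L ∈ C) (hξ : ξ ∈ L) : RelationsReflect (Hull A ξ) (Hull B ξ) C X := by
  intro D hD g hg hgX hgs
  obtain ⟨f, hfA, hf, hfu⟩ := (hA.mem_Hull_iff hθ).1 hg
  obtain ⟨F, hFA, hFX, hF⟩ := hA.exists_uncurry hθ hfA (hBA (hCB hL)) (hBA (hCB hD)) hX
  have hFξ : ∀ v y, pair (pair ξ v) y ∈ F ↔ pair v y ∈ g := by
    intro v y
    rw [hF]
    constructor
    · rintro ⟨-, -, -, g', hg', -, hvy, -⟩
      rwa [hfu g' hg'] at hvy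
    · intro hvy
      obtain ⟨hv, hy⟩ := pair_mem_prod.1 (hgX hvy)
      exact ⟨hξ, hv, hy, g, hf, hfu, hvy, fun y' h => hgs _ _ _ h hvy⟩
  -- Uniqueness was built into `F`, so it is single-valued with domain included in `L × D ∈ C`.
  have hFB : F ∈ B := by
    refine h _ (hC.prod_mem hμ hL hD) F hFA hFX fun a b b' hb hb' => ?_
    obtain ⟨c, -, v, -, rfl⟩ := mem_prod.1 (pair_mem_prod.1 (hFX hb)).1
    obtain ⟨-, -, -, g', hg', hu, hvy, hy⟩ := (hF _ _ _).1 hb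
    obtain ⟨-, -, -, g'', hg'', hu', hvy', hy'⟩ := (hF _ _ _).1 hb'
    obtain rfl := hu _ hg''
    exact hy' _ hvy
  obtain ⟨k, hkB, hk⟩ := hB.exists_curry hμ (hCB hL) hFB
  obtain ⟨b, hb, hbu, hbe⟩ := hk ξ hξ
  have hbg : b = g := by
    ext e
    rw [hbe]
    constructor
    · rintro ⟨v, y, rfl, h⟩
      exact (hFξ _ _).1 h
    · intro he
      obtain ⟨v, -, y, -, rfl⟩ := mem_prod.1 (hgX he)
      exact ⟨v, y, rfl, (hFξ _ _).2 he⟩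
  exact (hB.mem_Hull_iff hμ).2 ⟨k, hkB, hbg ▸ hb, fun y' hy' => (hbu y' hy').trans hbg⟩

/-- All answers `ξ` lie in the one set `⋃ K ∈ C`, so it serves as `L` in every round. -/
theorem RelationsReflect.model {K : ZFSet.{u}} (hK : ZFSet.sUnion K ∈ C) {r : List Round.{u}} :
    ∀ {A B : ZFSet.{u}}, RelationsReflect A B C X → IsElemSubmodel A (H θ) →
      IsElemSubmodel B (H μ) → B ⊆ A → C ⊆ B → X ∈ A → IsRun K B r →
      RelationsReflect (model A r) (model B r) C X := by
  induction r with
  | nil => exact fun h _ _ _ _ _ _ => h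
  | cons t r ih =>
    intro A B h hA hB hBA hCB hX hr
    have hξ : t.ξ ∈ ZFSet.sUnion K := mem_sUnion_of_mem hr.2.1.1 hr.1.1
    have hL := hCB hK
    exact ih (h.Hull hμ hθ hC hA hB hBA hCB hX hK hξ) (hA.Hull hθ (hBA hL) hξ)
      (hB.Hull hμ hL hξ) (Hull_mono hBA) (fun x hx => hB.subset_Hull hμ hL hξ (hCB hx))
      (hA.subset_Hull hθ (hBA hL) hξ hX) hr.2.2

/-- An element `x` of `X` is coded by the one-point function `{(∅, x)}`. -/
theorem RelationsReflect.mem {A B : ZFSet.{u}} (h : RelationsReflect A B C X)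
    (hA : IsElemSubmodel A (H θ)) (hB : IsElemSubmodel B (H μ)) {x : ZFSet.{u}} (hx : x ∈ A)
    (hxX : x ∈ X) : x ∈ B := by
  have h1 : ({pair ∅ x} : ZFSet.{u}) ∈ B := by
    refine h {∅} (hC.singleton_mem hμ (hC.empty_mem hμ)) _
      (hA.singleton_mem hθ (hA.pair_mem hθ (hA.empty_mem hθ) hx)) ?_ ?_
    · intro z hz
      rw [mem_singleton.1 hz, pair_mem_prod]
      exact ⟨mem_singleton.2 rfl, hxX⟩
    · intro a b b' hb hb'
      rw [(pair_inj.1 (mem_singleton.1 hb)).2, (pair_inj.1 (mem_singleton.1 hb')).2]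
  have h2 := hB.sUnion_mem hμ h1
  rw [sUnion_singleton] at h2
  exact hB.snd_mem hμ h2

omit hC in
/-- If `N ≺ H_θ` and `X ∈ N` is a subset of `H_μ`, then `N ⋉ r` and `(N ∩ H_μ) ⋉ r` have the same
elements in `X`. -/
theorem mem_model_inter_H {N K : ZFSet.{u}} (hN : IsElemSubmodel N (H θ))
    (hN' : IsElemSubmodel (N ∩ H μ) (H μ)) (hK : K ∈ N ∩ H μ) (hXN : X ∈ N) (hX : X ⊆ H μ)
    {r : List Round.{u}} (hr : IsRun K (N ∩ H μ) r) {x : ZFSet.{u}} (hx : x ∈ model N r)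
    (hxX : x ∈ X) : x ∈ model (N ∩ H μ) r := by
  have hsub : N ∩ H μ ⊆ N := fun x hx => (mem_inter.1 hx).1
  -- Before the first round, reflection only says that a single-valued relation with domain in `H_μ`
  -- and values in `X ⊆ H_μ` is in `H_μ`.
  have hQ : RelationsReflect N (N ∩ H μ) (N ∩ H μ) X := fun D hD g hg hgX hgs =>
    mem_inter.2 ⟨hg, H_of_singleValued hμ (hN'.1 hD) hX hgX hgs⟩
  exact (hQ.model hμ hθ hN' (hN'.sUnion_mem hμ hK) hN hN' hsub (fun _ h => h) hXN hr).mem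
    hμ hθ hN' (IsElemSubmodel.model hθ hN hsub hr).1
    (IsElemSubmodel.model hμ hN' (fun _ h => h) hr).1 hx hxX

end Reflect

/-! ### Conditions of the multiple Namba forcing -/

section Conditions

variable {μ : Cardinal.{u}} {K : ZFSet.{u}}

theorem IsCondition.triple_mem {p M S : ZFSet.{u}} {r : List Round.{u}} (hp : IsCondition μ K p)
    (h : triple M r S ∈ p) :
    InW0 μ K M ∧ IsWinningII K M S ∧ IsRun K M r ∧ Follows S r := by
  obtain ⟨M', r', S', heq, h'⟩ := hp.2.1 _ h
  obtain ⟨rfl, rfl, rfl⟩ := triple_inj.1 heq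
  exact h'

theorem IsCondition.subset {p q : ZFSet.{u}} (hq : IsCondition μ K q) (h : p ⊆ q) :
    IsCondition μ K p :=
  ⟨hq.1.subset fun _ hx => h hx, fun x hx => hq.2.1 x (h hx),
    fun M₁ r₁ S₁ M₂ r₂ S₂ h₁ h₂ => hq.2.2.1 M₁ r₁ S₁ M₂ r₂ S₂ (h h₁) (h h₂),
    fun M₁ r₁ S₁ M₂ r₂ S₂ h₁ h₂ => hq.2.2.2 M₁ r₁ S₁ M₂ r₂ S₂ (h h₁) (h h₂)⟩

theorem isCondition_singleton {M S : ZFSet.{u}} (hM : InW0 μ K M) (hS : IsWinningII K M S) :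
    IsCondition μ K {triple M [] S} := by
  refine ⟨by simp, fun x hx => ⟨M, [], S, mem_singleton.1 hx, hM, hS, trivial, ?_⟩,
    fun M₁ r₁ S₁ M₂ r₂ S₂ h₁ h₂ _ => (mem_singleton.1 h₁).trans (mem_singleton.1 h₂).symm,
    fun M₁ r₁ S₁ M₂ r₂ S₂ h₁ h₂ h => ?_⟩
  · intro s t h
    simp at h
  · rw [(triple_inj.1 (mem_singleton.1 h₁)).1, (triple_inj.1 (mem_singleton.1 h₂)).1] at h
    exact (mem_irrefl _ h).elim

theorem le_of_subset {p q : ZFSet.{u}} (h : p ⊆ q) : Le q p :=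
  fun _ r _ hr => ⟨r, h hr, List.prefix_refl r⟩

theorem IsCondition.model_elem (hμ : μ.IsRegular) {p M S : ZFSet.{u}} {r : List Round.{u}}
    (hp : IsCondition μ K p) (h : triple M r S ∈ p) : IsElemSubmodel (model M r) (H μ) :=
  (IsElemSubmodel.model hμ (hp.triple_mem h).1.2.1 (fun _ h => h) (hp.triple_mem h).2.2.1).1

variable (hμ : μ.IsRegular) (hω : ℵ₀ < μ)
include hμ hω

/-- If every triple of `u` has `r` as a subset of its last model, then `r ∪ u` is a condition. -/
theorem IsCondition.union {r u : ZFSet.{u}} (hr : IsCondition μ K r) (hu : IsCondition μ K u)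
    (h : ∀ M s S, triple M s S ∈ u → r ⊆ model M s) : IsCondition μ K (r ∪ u) := by
  -- Each model of `r` is an element of the last model of every triple of `u`, so its height is
  -- smaller. Hence mixed pairs never have equal heights, and only one order between them can occur.
  have key : ∀ M₁ r₁ S₁ M₂ r₂ S₂, triple M₁ r₁ S₁ ∈ r → triple M₂ r₂ S₂ ∈ u →
      M₁ ∩ omega1 ∈ M₂ ∩ omega1 := by
    intro M₁ r₁ S₁ M₂ r₂ S₂ h₁ h₂
    have hM := hu.model_elem hμ h₂
    have hW := (hr.triple_mem h₁).1
    rw [← model_inter_omega1 (hu.triple_mem h₂).2.2.1]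
    exact mem_inter.2 ⟨hW.2.1.inter_omega1_mem hμ hω hM hW.1 (hM.fst_mem hμ (h _ _ _ h₂ h₁)),
      hW.2.1.inter_omega1_mem_omega1 hμ hω hW.1⟩
  refine ⟨?_, ?_, ?_, ?_⟩
  · rw [coe_union]
    exact hr.1.union hu.1
  · intro x hx
    exact (mem_union.1 hx).elim (hr.2.1 x) (hu.2.1 x)
  · intro M₁ r₁ S₁ M₂ r₂ S₂ h₁ h₂ heq
    rcases mem_union.1 h₁ with h₁ | h₁ <;> rcases mem_union.1 h₂ with h₂ | h₂
    · exact hr.2.2.1 _ _ _ _ _ _ h₁ h₂ heq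
    · exact (mem_irrefl _ (heq ▸ key _ _ _ _ _ _ h₁ h₂)).elim
    · exact (mem_irrefl _ (heq ▸ key _ _ _ _ _ _ h₂ h₁)).elim
    · exact hu.2.2.1 _ _ _ _ _ _ h₁ h₂ heq
  · intro M₁ r₁ S₁ M₂ r₂ S₂ h₁ h₂ hlt
    rcases mem_union.1 h₁ with h₁ | h₁ <;> rcases mem_union.1 h₂ with h₂ | h₂
    · exact hr.2.2.2 _ _ _ _ _ _ h₁ h₂ hlt
    · exact h _ _ _ h₂ h₁
    · exact (mem_asymm hlt (key _ _ _ _ _ _ h₂ h₁)).elim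
    · exact hu.2.2.2 _ _ _ _ _ _ h₁ h₂ hlt

/-- A strategy is indexed by finite sequences from `K × ⋃ K`, and there are fewer than `μ` of them
since `μ` is uncountable. -/
theorem H_of_isStrategyII (hK : K ∈ H μ) {S : ZFSet.{u}} (hS : IsStrategyII K S) : S ∈ H μ := by
  classical
  have hKU := H_sUnion hμ hK
  have hP := H_prod hμ hK hKU
  let P := ZFSet.prod K (ZFSet.sUnion K)
  let dec : List (Shrink.{u} P) → List ZFSet.{u} :=
    fun l => l.map fun i => (((equivShrink P).symm i : P) : ZFSet.{u})
  have hdec : ∀ l, seqCode (dec l) ∈ H μ := by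
    intro l
    refine H_seqCode hμ fun m hm => ?_
    obtain ⟨i, -, rfl⟩ := List.mem_map.1 hm
    exact H_trans hμ hP ((equivShrink P).symm i).2
  let F : List (Shrink.{u} P) → ZFSet.{u} := fun l =>
    if h : ∃ ξ ∈ ZFSet.sUnion K, pair (seqCode (dec l)) ξ ∈ S then
      pair (seqCode (dec l)) h.choose else ∅
  have hι : #(List (Shrink.{u} P)) < μ :=
    (mk_list_le_max _).trans_lt (max_lt hω ((mem_H_iff hμ).1 hP).1)
  have hF : ∀ l, F l ∈ H μ := by
    intro l
    by_cases h : ∃ ξ ∈ ZFSet.sUnion K, pair (seqCode (dec l)) ξ ∈ S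
    · simp only [F, dif_pos h]
      exact H_pair hμ (hdec l) (H_trans hμ hKU h.choose_spec.1)
    · simp only [F, dif_neg h]
      exact H_empty hμ
  refine H_subset hμ (H_range hμ F hι hF) fun t ht => ?_
  obtain ⟨l, hl, hlm, ξ, hξ, rfl⟩ := hS.1 t ht
  have hlP : ∀ m ∈ l, m ∈ P := by
    intro m hm
    obtain ⟨κ, hκ, ν, hν, rfl⟩ := hlm m hm
    exact pair_mem_prod.2 ⟨hκ, mem_sUnion_of_mem hν hκ⟩
  let l' : List (Shrink.{u} P) := l.attach.map fun m => equivShrink P ⟨m.1, hlP m.1 m.2⟩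
  have hl' : dec l' = l := by
    simp [dec, l', Function.comp_def]
  have h : ∃ ξ ∈ ZFSet.sUnion K, pair (seqCode (dec l')) ξ ∈ S := ⟨ξ, hξ, by rwa [hl']⟩
  refine mem_range.2 ⟨l', ?_⟩
  have h1 := h.choose_spec.2
  simp only [F, dif_pos h]
  have h2 : h.choose = ξ := (hS.2 l hl hlm).unique (by simpa only [hl'] using h1) ht
  rw [h2, hl']

theorem P0_subset_H (hK : K ∈ H μ) : P0 μ K ⊆ H μ := by
  intro p hp
  have hp := mem_P0.1 hp
  refine H_of_finite hμ hp.1 fun x hx => ?_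
  obtain ⟨M, r, S, rfl, hM, hS, hr, -⟩ := hp.2.1 x hx
  refine H_pair hμ (H_of_countable hμ hω hM.1 hM.2.1.1) (H_pair hμ (H_seqCode hμ ?_)
    (H_of_isStrategyII hμ hω hK hS.1))
  intro m hm
  obtain ⟨t, ht, rfl⟩ := List.mem_map.1 hm
  obtain ⟨h1, h2, h3⟩ := round_mem_of_isRun hr t ht
  have hκ := H_trans hμ hK h1
  exact H_pair hμ (H_pair hμ hκ (H_trans hμ hκ h2)) (H_trans hμ hκ h3)

end Conditions

theorem omega1_subset_sUnion {K : ZFSet.{u}} (hK : ∀ κ ∈ K, IsUncountableRegular κ)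
    {κ : ZFSet.{u}} (hκ : κ ∈ K) : omega1 ⊆ ZFSet.sUnion K := by
  obtain ⟨c, -, hc, rfl⟩ := hK κ hκ
  intro x hx
  refine mem_sUnion_of_mem (Ordinal.toZFSet_subset_toZFSet_iff.2 (ord_le_ord.2 ?_) hx) hκ
  rw [← succ_aleph0]
  exact Order.succ_le_of_lt hc

theorem traceBelow_subset {q N : ZFSet.{u}} : traceBelow q N ⊆ q := sep_subset

/-! ### The trace when `μ` is uncountable -/

section Trace

variable {K : ZFSet.{u}} (hK : ∀ κ ∈ K, IsUncountableRegular κ) {μ θ : Cardinal.{u}}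
  (hμ : μ.IsRegular) (hθ : θ.IsRegular) {N : ZFSet.{u}}
  (hNθ : IsElemSubmodel N (H θ)) (hPN : P0 μ K ∈ N) (hNW : InW0 μ K (N ∩ H μ))
include hμ hNW

include hK hθ hNθ hPN in
/-- The case of an uncountable `μ`. -/
theorem isTrace_traceBelow (hω : ℵ₀ < μ) {q S : ZFSet.{u}} {s : List Round.{u}}
    (hq : q ∈ P0 μ K) (hs : triple (N ∩ H μ) s S ∈ q) :
    IsTrace (P0 μ K) Le N q (traceBelow q N) := by
  have hqc := mem_P0.1 hq
  have hrun := (hqc.triple_mem hs).2.2.1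
  have hKN : K ∈ N := (mem_inter.1 hNW.2.2.1).1
  have hKH : K ∈ H μ := (mem_inter.1 hNW.2.2.1).2
  have hB : IsElemSubmodel (model (N ∩ H μ) s) (H μ) := hqc.model_elem hμ hs
  obtain ⟨hA, -, hBA⟩ := IsElemSubmodel.model hθ hNθ
    (fun _ h => (mem_inter.1 h).1 : N ∩ H μ ⊆ N) hrun
  have ht : traceBelow q N ∈ P0 μ K := mem_P0.2 (hqc.subset traceBelow_subset)
  -- Coherence with the triple at `N` puts each triple of the trace into this model, and elementary
  -- submodels contain their finite subsets.
  have htB : traceBelow q N ∈ model (N ∩ H μ) s := by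
    refine hB.mem_of_finite hμ (mem_P0.1 ht).1 fun x hx => ?_
    obtain ⟨hxq, M, r, S', rfl, hM⟩ := mem_sep.1 hx
    have hMW := (hqc.triple_mem hxq).1
    have h1 := hMW.2.1.inter_omega1_mem_omega1 hμ hω hMW.1
    exact hqc.2.2.2 _ _ _ _ _ _ hxq hs
      (mem_inter.2 ⟨mem_inter.2 ⟨hM, omega1_subset_H hμ hω h1⟩, h1⟩)
  have hHull : Hull N (traceBelow q N) ⊆ model N s :=
    hA.Hull_subset hθ (IsElemSubmodel.model hθ hNθ
      (fun _ h => (mem_inter.1 h).1 : N ∩ H μ ⊆ N) hrun).2.1 (hBA htB)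
  refine ⟨ht, ?_, fun r hr hrP hrt => ?_⟩
  · ext y
    rw [mem_inter, mem_inter]
    refine and_congr_left fun hy => ⟨fun h => ?_, fun h => hNθ.subset_Hull hθ hPN ht h⟩
    have hyA := hHull h
    -- The empty run is separate: `K` may be empty, whereas a first round supplies some `κ ∈ K`, and
    -- then `ω₁ ⊆ ⋃ K`.
    cases s with
    | nil => exact hyA
    | cons t s =>
      have hyB := mem_model_inter_H hμ hθ hNθ hNW.2.1 hNW.2.2.1 (hNθ.sUnion_mem hθ hKN)
        (fun _ h => H_trans hμ (H_sUnion hμ hKH) h) hrun hyA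
        (omega1_subset_sUnion hK hrun.1.1 hy)
      have h2 := mem_inter.2 ⟨hyB, hy⟩
      rw [model_inter_omega1 hrun] at h2
      exact (mem_inter.1 (mem_inter.1 h2).1).1
  · have hrc := mem_P0.1 hrP
    -- Reflection with `X = P0`: the condition `r` is an element of the model, and its finiteness
    -- makes it a subset.
    have hrB : r ⊆ model (N ∩ H μ) s := hB.subset_of_finite hμ hω
      (mem_model_inter_H hμ hθ hNθ hNW.2.1 hNW.2.2.1 hPN (P0_subset_H hμ hω hKH) hrun
        (hHull hr) hrP) hrc.1
    -- The common extension of `r` and `q` is `r` together with the part of `q` not below `N`.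
    let v : ZFSet.{u} := ZFSet.sep (fun x => x ∉ traceBelow q N) q
    have hv : IsCondition μ K v := hqc.subset sep_subset
    refine ⟨r ∪ v, mem_P0.2 (hrc.union hμ hω hv fun M r' S' h => ?_),
      le_of_subset fun x hx => mem_union.2 (.inl hx), fun M r' S' h => ?_⟩
    · obtain ⟨hMq, hMt⟩ := mem_sep.1 h
      have hMN : M ∩ omega1 ∉ N := fun h => hMt (mem_sep.2 ⟨hMq, M, r', S', rfl, h⟩)
      have hMW := (hqc.triple_mem hMq).1
      -- The height of `M` is compared with that of `N`: smaller is excluded, equal means the triple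
      -- at `N` itself, and if larger, the last model of the triple has the triple at `N` as an
      -- element and so includes `(N ∩ H_μ) ⋉ s`.
      rcases (hMW.2.1.inter_omega1_isOrdinal hμ hω).mem_trichotomous
        (hNW.2.1.inter_omega1_isOrdinal hμ hω) with h1 | h1 | h1
      · exact (hMN (mem_inter.1 (mem_inter.1 h1).1).1).elim
      · obtain ⟨rfl, rfl, -⟩ := triple_inj.1 (hqc.2.2.1 _ _ _ _ _ _ hMq hs h1)
        exact hrB
      · intro x hx
        exact (hqc.model_elem hμ hMq).model_subset_of_triple_mem hμ hω hNW.1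
          (hqc.2.2.2 _ _ _ _ _ _ hs hMq h1) (hrB hx)
    · by_cases ht : triple M r' S' ∈ traceBelow q N
      · obtain ⟨r'', h1, h2⟩ := hrt _ _ _ ht
        exact ⟨r'', mem_union.2 (.inl h1), h2⟩
      · exact ⟨r', mem_union.2 (.inr (mem_sep.2 ⟨h, ht⟩)), List.prefix_refl _⟩

theorem isCondition_union_triple (hω : ℵ₀ < μ) {p S : ZFSet.{u}} (hp : p ∈ P0 μ K) (hpN : p ∈ N)
    (hS : IsWinningII K (N ∩ H μ) S) : p ∪ {triple (N ∩ H μ) [] S} ∈ P0 μ K := by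
  have hpH := P0_subset_H hμ hω (mem_inter.1 hNW.2.2.1).2 hp
  refine mem_P0.2 ((mem_P0.1 hp).union hμ hω (isCondition_singleton hNW hS) fun M s S' h => ?_)
  obtain ⟨rfl, rfl, -⟩ := triple_inj.1 (mem_singleton.1 h)
  exact hNW.2.1.subset_of_finite hμ hω (mem_inter.2 ⟨hpN, hpH⟩) (mem_P0.1 hp).1

end Trace

/-! ### The degenerate case `μ = ℵ₀` -/

section CountableCase

/-- By `∈`-induction, since elements of `H_ℵ₀` are finite and `M` contains its finite subsets. -/
theorem eq_H_aleph0 {M : ZFSet.{u}} (hM : IsElemSubmodel M (H ℵ₀)) : M = H ℵ₀ := by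
  ext x
  refine ⟨fun h => hM.1 h, ?_⟩
  induction x using ZFSet.inductionOn with
  | _ x ih =>
    intro hx
    refine hM.mem_of_finite isRegular_aleph0 ?_
      fun y hy => ih y hy (H_trans isRegular_aleph0 hx hy)
    have h1 := ((mem_H_iff isRegular_aleph0).1 hx).1
    rw [← lift_lt_aleph0.{u, u + 1}, ← cardinalMk_coe_sort, lt_aleph0_iff_finite] at h1
    exact h1

variable {K N S : ZFSet.{u}} (hK : ∀ κ ∈ K, IsUncountableRegular κ) (hKH : K ∈ H ℵ₀)
include hK hKH

theorem eq_empty_of_mem_H_aleph0 : K = ∅ := by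
  refine (eq_empty K).2 fun κ hκ => ?_
  obtain ⟨c, -, hc, rfl⟩ := hK κ hκ
  have h := ((mem_H_iff isRegular_aleph0).1 (H_trans isRegular_aleph0 hKH hκ)).1
  rw [Ordinal.card_toZFSet, card_ord] at h
  exact hc.not_gt h

/-- For `μ = ℵ₀` there is only one triple that occurs in conditions. -/
theorem eq_triple_of_mem {M : ZFSet.{u}} (hM : IsElemSubmodel M (H ℵ₀)) (hS : IsStrategyII K S)
    {p x : ZFSet.{u}} (hp : IsCondition ℵ₀ K p) (hx : x ∈ p) : x = triple M [] S := by
  have hstrat : ∀ S', IsStrategyII K S' → S' = ∅ := by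
    refine fun S' hS' => (eq_empty S').2 fun t ht => ?_
    obtain ⟨l, hl, hm, -⟩ := hS'.1 t ht
    obtain ⟨m, hml⟩ := List.exists_mem_of_ne_nil l hl
    obtain ⟨κ, hκ, -⟩ := hm m hml
    rw [eq_empty_of_mem_H_aleph0 hK hKH] at hκ
    exact notMem_empty _ hκ
  obtain ⟨M', r, S', rfl, hW, hS', hr, -⟩ := hp.2.1 x hx
  rw [eq_H_aleph0 hM, eq_H_aleph0 hW.2.1, hstrat S hS, hstrat S' hS'.1]
  cases r with
  | nil => rfl
  | cons t r =>
    have h := hr.1.1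
    rw [eq_empty_of_mem_H_aleph0 hK hKH] at h
    exact (notMem_empty _ h).elim

end CountableCase

/-- The case `μ = ℵ₀`. -/
theorem isTrace_traceBelow_aleph0 {K N S : ZFSet.{u}} (hK : ∀ κ ∈ K, IsUncountableRegular κ)
    {θ : Cardinal.{u}} (hθ : θ.IsRegular) (hθω : ℵ₀ < θ) (hNθ : IsElemSubmodel N (H θ))
    (hPN : P0 ℵ₀ K ∈ N) (hNW : InW0 ℵ₀ K (N ∩ H ℵ₀)) (hS : IsWinningII K (N ∩ H ℵ₀) S)
    {q : ZFSet.{u}} {s : List Round.{u}} (hq : q ∈ P0 ℵ₀ K)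
    (hs : triple (N ∩ H ℵ₀) s S ∈ q) : IsTrace (P0 ℵ₀ K) Le N q (traceBelow q N) := by
  have hKH : K ∈ H ℵ₀ := (mem_inter.1 hNW.2.2.1).2
  have hsub : ∀ p ∈ P0 ℵ₀ K, p ⊆ q := by
    intro p hp x hx
    rw [eq_triple_of_mem hK hKH hNW.2.1 hS.1 (mem_P0.1 hp) hx,
      ← eq_triple_of_mem hK hKH hNW.2.1 hS.1 (mem_P0.1 hq) hs]
    exact hs
  have ht : traceBelow q N ∈ P0 ℵ₀ K := mem_P0.2 ((mem_P0.1 hq).subset traceBelow_subset)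
  -- Every condition is a subset of the finite set `q`. So `P0` is finite and all conditions are in
  -- `N`, which makes the hull trivial.
  have hfin : (P0 ℵ₀ K : Set ZFSet.{u}).Finite := by
    refine ((mem_P0.1 hq).1.powerset.preimage (f := fun p : ZFSet.{u} => (p : Set ZFSet.{u}))
      SetLike.coe_injective.injOn).subset fun p hp => ?_
    exact fun x hx => hsub p hp hx
  have htN : traceBelow q N ∈ N := hNθ.subset_of_finite hθ hθω hPN hfin ht
  refine ⟨ht, ?_, fun r _ hr _ => ⟨q, hq, le_of_subset (hsub r hr), le_of_subset fun _ h => h⟩⟩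
  ext y
  rw [mem_inter, mem_inter]
  exact and_congr_left fun _ => ⟨fun h => hNθ.Hull_subset hθ (fun _ h => h) htN h,
    fun h => hNθ.subset_Hull hθ hPN ht h⟩

theorem aleph0_lt_of_muchLess {μ θ : Cardinal.{u}} (hμ : μ.IsRegular) (hθ : θ.IsRegular)
    (h : MuchLess μ.ord.toZFSet θ) : ℵ₀ < θ := by
  have h1 := ((mem_H_iff hθ).1 h).1
  rw [card_powerset, card_powerset, Ordinal.card_toZFSet, card_ord] at h1
  exact hμ.aleph0_le.trans_lt (((cantor μ).trans (cantor _)).trans h1)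

end NambaForcing

/-! ### The proposition -/

theorem mainTheorem6
    (K : ZFSet.{u}) (hK : ∀ κ ∈ K, NambaForcing.IsUncountableRegular κ)
    (hK₁ : NambaForcing.omega1 ∉ K)
    (μ : Cardinal.{u}) (hμ : μ.IsRegular)
    (hKμ : NambaForcing.MuchLess (ZFSet.sUnion K) μ)
    (θ : Cardinal.{u}) (hθ : θ.IsRegular)
    (hμθ : NambaForcing.MuchLess μ.ord.toZFSet θ)
    (N : ZFSet.{u}) (hNcard : N.card ≤ Cardinal.aleph0)
    (hNθ : NambaForcing.IsElemSubmodel N (NambaForcing.H θ))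
    (hPN : NambaForcing.P0 μ K ∈ N)
    (hNW : NambaForcing.InW0 μ K (N ∩ NambaForcing.H μ)) :
    NambaForcing.StronglySemiproper (NambaForcing.P0 μ K) NambaForcing.Le N ∧
    ∀ p ∈ NambaForcing.P0 μ K, p ∈ N →
      ∀ S, NambaForcing.IsWinningII K (N ∩ NambaForcing.H μ) S →
        ∃ p' : ZFSet.{u}, p' = p ∪ {NambaForcing.triple (N ∩ NambaForcing.H μ) [] S} ∧
          NambaForcing.Le p' p ∧
          NambaForcing.StronglySemigeneric (NambaForcing.P0 μ K) NambaForcing.Le N p' ∧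
          ∀ q ∈ NambaForcing.P0 μ K, NambaForcing.Le q p' →
            NambaForcing.IsTrace (NambaForcing.P0 μ K) NambaForcing.Le N q
              (NambaForcing.traceBelow q N) := by
  have hθω := NambaForcing.aleph0_lt_of_muchLess hμ hθ hμθ
  have htrace : ∀ q S s, NambaForcing.IsWinningII K (N ∩ NambaForcing.H μ) S →
      q ∈ NambaForcing.P0 μ K → NambaForcing.triple (N ∩ NambaForcing.H μ) s S ∈ q →
        NambaForcing.IsTrace (NambaForcing.P0 μ K) NambaForcing.Le N q
          (NambaForcing.traceBelow q N) := by
    intro q S s hS hq hs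
    -- For `K = ∅` the hypotheses allow `μ = ℵ₀`.
    rcases hμ.aleph0_le.eq_or_lt with rfl | hω
    · exact NambaForcing.isTrace_traceBelow_aleph0 hK hθ hθω hNθ hPN hNW hS hq hs
    · exact NambaForcing.isTrace_traceBelow hK hμ hθ hNθ hPN hNW hω hq hs
  have hcond : ∀ p S, p ∈ NambaForcing.P0 μ K → p ∈ N →
      NambaForcing.IsWinningII K (N ∩ NambaForcing.H μ) S →
        p ∪ {NambaForcing.triple (N ∩ NambaForcing.H μ) [] S} ∈ NambaForcing.P0 μ K := by
    intro p S hp hpN hS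
    rcases hμ.aleph0_le.eq_or_lt with rfl | hω
    · have hT := NambaForcing.isCondition_singleton hNW hS
      refine NambaForcing.mem_P0.2 (hT.subset fun x hx => ?_)
      -- All elements of `p` equal the one possible triple, so the union is included in a singleton
      -- condition.
      rcases ZFSet.mem_union.1 hx with hx | hx
      · exact ZFSet.mem_singleton.2 (NambaForcing.eq_triple_of_mem hK
          (ZFSet.mem_inter.1 hNW.2.2.1).2 hNW.2.1 hS.1 (NambaForcing.mem_P0.1 hp) hx)
      · exact hx
    · exact NambaForcing.isCondition_union_triple hμ hNW hω hp hpN hS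
  have main : ∀ p ∈ NambaForcing.P0 μ K, p ∈ N →
      ∀ S, NambaForcing.IsWinningII K (N ∩ NambaForcing.H μ) S →
        ∃ p' : ZFSet.{u}, p' = p ∪ {NambaForcing.triple (N ∩ NambaForcing.H μ) [] S} ∧
          NambaForcing.Le p' p ∧
          NambaForcing.StronglySemigeneric (NambaForcing.P0 μ K) NambaForcing.Le N p' ∧
          ∀ q ∈ NambaForcing.P0 μ K, NambaForcing.Le q p' →
            NambaForcing.IsTrace (NambaForcing.P0 μ K) NambaForcing.Le N q
              (NambaForcing.traceBelow q N) := by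
    intro p hp hpN S hS
    have ht : ∀ q ∈ NambaForcing.P0 μ K,
        NambaForcing.Le q (p ∪ {NambaForcing.triple (N ∩ NambaForcing.H μ) [] S}) →
          NambaForcing.IsTrace (NambaForcing.P0 μ K) NambaForcing.Le N q
            (NambaForcing.traceBelow q N) := by
      intro q hq hle
      -- The order yields the triple at `N` in `q` with some run `s` extending the empty one;
      -- nothing else about `q ≤ p*` is needed for the trace.
      obtain ⟨s, hs, -⟩ := hle _ _ _ (ZFSet.mem_union.2 (.inr (ZFSet.mem_singleton.2 rfl)))
      exact htrace q S s hS hq hs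
    exact ⟨_, rfl, NambaForcing.le_of_subset fun x hx => ZFSet.mem_union.2 (.inl hx),
      ⟨hcond p S hp hpN hS, fun q hq hle => ⟨_, ht q hq hle⟩⟩, ht⟩
  refine ⟨fun p hp hpN => ?_, main⟩
  obtain ⟨S, hS⟩ := hNW.2.2.2
  obtain ⟨p', -, hle, hgen, -⟩ := main p hp hpN S hS
  exact ⟨p', hle, hgen⟩
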